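/- Throughout, locally compact abelian groups (LCAG) are Hausdorff. A \emph{lattice} is a discrete co-compact subgroup. A \emph{cut-and-project scheme} (CPS) $(G,H,\mathcal L)$ consists of LCAG $G,H$ and a lattice $\mathcal L\subset G\times H$ such that the projection $\pi^G$ is injective on $\mathcal L$ and $\pi^H(\mathcal L)$ is dense in $H$. Put $L=\pi^G(\mathcal L)$ and, for $\ell\in L$, let $\ell^\star\in H$ be the unique element with $(\ell,\ell^\star)\in\mathcal L$. A \emph{model set} in $(G,H,\mathcal L)$ is a set $\{\ell\in L:\ell^\star\in W\}$ with $W\subset H$ relatively compact with nonempty interior. A \emph{deformed weighted model set} in $(G,H,\mathcal L)$ is a measure $\sum_{\ell\in L}f(\ell^\star)\,\delta_{\ell+p(\ell^\star)}$ with $f\in C_c(H)$ complex valued and $p\in C(H,G)$; it is a \emph{deformed weighted variant} of a model set $\Lambda$ if $f(\ell^\star)=0$ for all $\ell\in L\setminus\Lambda$. Given a CPS $(G,H_0,\mathcal L_0)$ with star map $\star_0$ on $L_0=\pi^G(\mathcal L_0)$, let $i_{\mathsf b}:G\to G_{\mathsf b}$ be the canonical map to the Bohr compactification. Its \emph{extended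 CPS} is $(G,H,\mathcal L)$, where $\mathcal L=\{(\ell,(\ell^{\star_0},i_{\mathsf b}(\ell))):\ell\in L_0\}$ and $H$ is the closure of $\{(\ell^{\star_0},i_{\mathsf b}(\ell)):\ell\in L_0\}$ in $H_0\times G_{\mathsf b}$. A uniformly continuous and bounded function $h$ on $G$ with values in $\mathbb C$ or in $G$ (bounded meaning relatively compact range) is \emph{almost periodic} if for every zero neighbourhood $V$ the set $\{t\in G: h(x-t)-h(x)\in V\text{ for all }x\in G\}$ is relatively dense in $G$. A \emph{modulation} of a complex Radon measure $\nu$ on $G$ is a measure $\nu^{w,g}$, $\nu^{w,g}(\varphi)=\int w(x)\,\varphi(x+g(x))\,\mathrm d\nu(x)$ for $\varphi\in C_c(G)$, with $w:G\to\mathbb C$ and $g:G\to G$ almost periodic. A class of measures is \emph{modulation stable} if it contains every modulation of each of its members. A measure $\nu$ is \emph{strongly almost periodic} if it is translation bounded and $\nu*\varphi$ is almost periodic for every $\varphi\in C_c(G)$. An \emph{ideal crystal} is a locally finite set $\Lambda\subset G$ whose period group $\{t\in G:t+\Lambda=\Lambda\}$ is a lattice in $G$; a modulation of $\Lambda$ is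 a modulation of its Dirac comb $\sum_{x\in\Lambda}\delta_x$. \textbf{Theorem.} Let $(G,H_0,\mathcal L_0)$ be any CPS, let $(G,H,\mathcal L)$ be its extended CPS, and let $\Lambda\subset G$ be an ideal crystal that is a model set in $(G,H,\mathcal L)$. Then: (1) every modulation of $\Lambda$ is a deformed weighted variant of the model set $\Lambda$ in $(G,H,\mathcal L)$; (2) every modulation of $\Lambda$ is strongly almost periodic; (3) if $G=\mathbb R^d$, then the class of modulations of $\Lambda$ coincides with the class of deformed weighted variants of the model set $\Lambda$ in $(G,H,\mathcal L)$; (4) the class of deformed weighted model sets in $(G,H,\mathcal L)$ and the class of modulations of $\Lambda$ are both modulation stable. -/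

import Mathlib

open Set Topology Pointwise
open scoped CompactlySupported

noncomputable section

namespace CutProject

/-! ### Complex Radon measures on a locally compact space -/

/-- A complex Radon measure on `X`: a linear functional on `C_c(X, ℂ)` that is continuous for the
inductive limit topology, i.e. bounded for the sup norm on the functions supported in any fixed
compact set. -/
structure RadonMeasure (X : Type*) [TopologicalSpace X] where
  /-- the functional `φ ↦ ∫ φ dμ` -/
  toLin : C_c(X, ℂ) →ₗ[ℂ] ℂ
  bound : ∀ K : Set X, IsCompact K → ∃ C : ℝ, ∀ φ : C_c(X, ℂ), tsupport φ ⊆ K →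
    ∀ B : ℝ, (∀ x, ‖φ x‖ ≤ B) → ‖toLin φ‖ ≤ C * B

theorem finite_support_comb {X ι : Type*} [TopologicalSpace X] (c : ι → ℂ) (x : ι → X)
    (h : ∀ K : Set X, IsCompact K → {i | c i ≠ 0 ∧ x i ∈ K}.Finite) (φ : C_c(X, ℂ)) :
    (Function.support fun i => c i * φ (x i)).Finite := by
  refine (h _ φ.hasCompactSupport).subset fun i hi => ?_
  rw [Function.mem_support] at hi
  exact ⟨left_ne_zero_of_mul hi, subset_tsupport _ (right_ne_zero_of_mul hi)⟩

/-- The weighted Dirac comb `∑ i, c i • δ_(x i)`, where only finitely many points of nonzero weight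
(counted with multiplicity) lie in any compact set; all sums below have finite support. -/
def weightedComb {X ι : Type*} [TopologicalSpace X] (c : ι → ℂ) (x : ι → X)
    (h : ∀ K : Set X, IsCompact K → {i | c i ≠ 0 ∧ x i ∈ K}.Finite) : RadonMeasure X where
  toLin :=
    { toFun := fun φ => ∑ᶠ i, c i * φ (x i)
      map_add' := fun φ ψ => by
        rw [← finsum_add_distrib (finite_support_comb c x h φ) (finite_support_comb c x h ψ)]
        exact finsum_congr fun i => by
          rw [CompactlySupportedContinuousMap.add_apply, mul_add]
      map_smul' := fun a φ => by
        rw [RingHom.id_apply, smul_eq_mul, mul_finsum]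
        exact finsum_congr fun i => by
          rw [CompactlySupportedContinuousMap.smul_apply, smul_eq_mul]; ring }
  bound := fun K hK => by
    refine ⟨∑ i ∈ (h K hK).toFinset, ‖c i‖, fun φ hφ B hB => ?_⟩
    have hs : (Function.support fun i => c i * φ (x i)) ⊆ ((h K hK).toFinset : Set ι) := by
      intro i hi
      rw [Function.mem_support] at hi
      rw [Set.Finite.coe_toFinset]
      exact ⟨left_ne_zero_of_mul hi, hφ (subset_tsupport _ (right_ne_zero_of_mul hi))⟩
    change ‖∑ᶠ i, c i * φ (x i)‖ ≤ _
    rw [finsum_eq_sum_of_support_subset _ hs, Finset.sum_mul]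
    refine (norm_sum_le _ _).trans (Finset.sum_le_sum fun i _ => ?_)
    rw [norm_mul]
    exact mul_le_mul_of_nonneg_left (hB _) (norm_nonneg _)

/-- A point set is locally finite if it has finitely many points in every compact set. -/
def IsLocallyFinite {X : Type*} [TopologicalSpace X] (Λ : Set X) : Prop :=
  ∀ K : Set X, IsCompact K → (Λ ∩ K).Finite

/-- The Dirac comb `δ_Λ = ∑ x ∈ Λ, δ_x` of a locally finite point set. -/
def diracComb {X : Type*} [TopologicalSpace X] (Λ : Set X) (h : IsLocallyFinite Λ) :
    RadonMeasure X :=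
  weightedComb (ι := Λ) (fun _ => 1) (fun x => (x : X)) fun K hK =>
    Set.Finite.of_finite_image ((h K hK).subset (by rintro _ ⟨i, hi, rfl⟩; exact ⟨i.2, hi.2⟩))
      Subtype.val_injective.injOn

/-! ### Almost periodic functions and modulations of measures -/

/-- `A` is relatively dense in `G` if `A + K = G` for some compact `K`. -/
def IsRelativelyDense {G : Type*} [AddCommGroup G] [TopologicalSpace G] (A : Set G) : Prop :=
  ∃ K : Set G, IsCompact K ∧ A + K = univ

/-- A function `f : G → E` between topological abelian groups is almost periodic if it is uniformly
continuous and bounded (has relatively compact range), and for every neighbourhood `V` of zero its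
set of `V`-almost periods is relatively dense. -/
structure IsAlmostPeriodic {G E : Type*} [AddCommGroup G] [TopologicalSpace G]
    [AddCommGroup E] [TopologicalSpace E] (f : G → E) : Prop where
  uniformContinuous : ∀ V ∈ 𝓝 (0 : E), ∃ U ∈ 𝓝 (0 : G), ∀ x y, x - y ∈ U → f x - f y ∈ V
  bounded : IsCompact (closure (range f))
  relativelyDense : ∀ V ∈ 𝓝 (0 : E), IsRelativelyDense {t : G | ∀ x, f (x - t) - f x ∈ V}

theorem IsAlmostPeriodic.continuous {G E : Type*} [AddCommGroup G] [TopologicalSpace G]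
    [IsTopologicalAddGroup G] [AddCommGroup E] [TopologicalSpace E] [IsTopologicalAddGroup E]
    {f : G → E} (hf : IsAlmostPeriodic f) : Continuous f := by
  refine continuous_iff_continuousAt.2 fun x => ?_
  have h : Filter.Tendsto (fun y => f y - f x) (𝓝 x) (𝓝 0) := by
    intro V hV
    obtain ⟨U, hU, h⟩ := hf.uniformContinuous V hV
    have h0 : Filter.Tendsto (fun y : G => y - x) (𝓝 x) (𝓝 0) := by
      have : Continuous fun y : G => y - x := continuous_id.sub continuous_const
      simpa using this.tendsto x
    have h1 : ∀ᶠ y in 𝓝 x, y - x ∈ U := h0 hU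
    exact h1.mono fun y hy => h y x hy
  simpa [ContinuousAt] using h.add_const (f x)

theorem isCompact_sub {G : Type*} [AddCommGroup G] [TopologicalSpace G] [IsTopologicalAddGroup G]
    {s t : Set G} (hs : IsCompact s) (ht : IsCompact t) : IsCompact (s - t) := by
  rw [sub_eq_add_neg]
  exact hs.add ht.neg

theorem modTest_eq_zero {G : Type*} [AddCommGroup G] [TopologicalSpace G] {w : G → ℂ} {g : G → G}
    (φ : C_c(G, ℂ)) {x : G} (hx : x ∉ tsupport φ - closure (range g)) :
    w x * φ (x + g x) = 0 := by
  have : φ (x + g x) = 0 := by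
    by_contra h
    exact hx ⟨x + g x, subset_tsupport _ h, g x, subset_closure ⟨x, rfl⟩, add_sub_cancel_right _ _⟩
  rw [this, mul_zero]

section Group

variable {G : Type*} [AddCommGroup G] [TopologicalSpace G] [IsTopologicalAddGroup G] [T2Space G]

/-- The test function `x ↦ w x * φ (x + g x)`. -/
def modTest (w : G → ℂ) (g : G → G) (hw : IsAlmostPeriodic w) (hg : IsAlmostPeriodic g)
    (φ : C_c(G, ℂ)) : C_c(G, ℂ) where
  toFun := fun x => w x * φ (x + g x)
  continuous_toFun := hw.continuous.mul (φ.continuous.comp (continuous_id.add hg.continuous))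
  hasCompactSupport' := HasCompactSupport.intro
    (isCompact_sub φ.hasCompactSupport hg.bounded) fun _ hx => modTest_eq_zero φ hx

/-- The modulation `ν^{w,g}` of the measure `ν` with almost periodic modulation functions `w`, `g`:
`ν^{w,g}(φ) = ∫ w x * φ (x + g x) dν(x)`. -/
def RadonMeasure.modulate (ν : RadonMeasure G) (w : G → ℂ) (g : G → G) (hw : IsAlmostPeriodic w)
    (hg : IsAlmostPeriodic g) : RadonMeasure G where
  toLin :=
    { toFun := fun φ => ν.toLin (modTest w g hw hg φ)
      map_add' := fun φ ψ => by
        rw [← map_add]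
        congr 1
        ext x
        exact mul_add (w x) (φ (x + g x)) (ψ (x + g x))
      map_smul' := fun a φ => by
        rw [RingHom.id_apply, ← map_smul]
        congr 1
        ext x
        exact mul_left_comm (w x) a (φ (x + g x)) }
  bound := fun K hK => by
    have hK' : IsCompact (K - closure (range g)) := isCompact_sub hK hg.bounded
    obtain ⟨C, hC⟩ := ν.bound _ hK'
    obtain ⟨M, hM⟩ := hw.bounded.isBounded.exists_norm_le
    refine ⟨C * M, fun φ hφ B hB => ?_⟩
    rw [mul_assoc]
    refine hC _ ?_ (M * B) fun x => ?_
    · refine closure_minimal (fun x hx => ?_) hK'.isClosed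
      by_contra h
      exact hx (modTest_eq_zero φ fun h' => h (Set.sub_subset_sub_right hφ h'))
    · change ‖w x * φ (x + g x)‖ ≤ _
      rw [norm_mul]
      have h1 := hM _ (subset_closure ⟨x, rfl⟩)
      exact mul_le_mul h1 (hB _) (norm_nonneg _) ((norm_nonneg _).trans h1)

/-- `μ` is a modulation of the measure `ν`. -/
def RadonMeasure.IsModulation (ν μ : RadonMeasure G) : Prop :=
  ∃ (w : G → ℂ) (g : G → G) (hw : IsAlmostPeriodic w) (hg : IsAlmostPeriodic g),
    μ = ν.modulate w g hw hg

/-- A class of measures is modulation stable if it contains all modulations of its members. -/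
def IsModulationStable (S : Set (RadonMeasure G)) : Prop :=
  ∀ ν ∈ S, ∀ μ, ν.IsModulation μ → μ ∈ S

/-- The modulations of the locally finite point set `Λ` are those of its Dirac comb, i.e. the
measures `∑ x ∈ Λ, w x • δ_(x + g x)`. -/
def modulations (Λ : Set G) (h : IsLocallyFinite Λ) : Set (RadonMeasure G) :=
  {μ | (diracComb Λ h).IsModulation μ}

/-! ### Strongly almost periodic measures -/

/-- `ν` is translation bounded: `|ν| (t + V) ≤ C` for all `t`, for some constant `C` and some
nonempty open relatively compact `V`. The total variation `|ν|` of an open set is the supremum of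
`|ν ψ|` over the test functions `ψ` supported in that set with `|ψ| ≤ 1`. -/
def RadonMeasure.IsTranslationBounded (ν : RadonMeasure G) : Prop :=
  ∃ (V : Set G) (C : ℝ), IsOpen V ∧ V.Nonempty ∧ IsCompact (closure V) ∧
    ∀ (t : G) (ψ : C_c(G, ℂ)), tsupport ψ ⊆ t +ᵥ V → (∀ x, ‖ψ x‖ ≤ 1) → ‖ν.toLin ψ‖ ≤ C

/-- The test function `u ↦ φ (s - u)`. -/
def reflectTest (φ : C_c(G, ℂ)) (s : G) : C_c(G, ℂ) where
  toFun := fun u => φ (s - u)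
  continuous_toFun := φ.continuous.comp (continuous_const.sub continuous_id)
  hasCompactSupport' := φ.hasCompactSupport.comp_homeomorph (Homeomorph.subLeft s)

/-- The convolution `(ν * φ) s = ∫ φ (s - u) dν(u)`. -/
def RadonMeasure.conv (ν : RadonMeasure G) (φ : C_c(G, ℂ)) (s : G) : ℂ :=
  ν.toLin (reflectTest φ s)

/-- `ν` is strongly almost periodic: it is translation bounded and all convolutions with test
functions are almost periodic functions. -/
def RadonMeasure.IsStronglyAlmostPeriodic (ν : RadonMeasure G) : Prop :=
  ν.IsTranslationBounded ∧ ∀ φ : C_c(G, ℂ), IsAlmostPeriodic (ν.conv φ)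

/-! ### Lattices and ideal crystals -/

/-- A lattice is a discrete co-compact (i.e. relatively dense) subgroup. -/
structure IsLattice {A : Type*} [AddCommGroup A] [TopologicalSpace A] (Γ : AddSubgroup A) :
    Prop where
  discrete : DiscreteTopology Γ
  cocompact : IsRelativelyDense (Γ : Set A)

/-- An ideal crystal is a locally finite set whose period group `{t | t + Λ = Λ}` is a lattice. -/
structure IsIdealCrystal (Λ : Set G) : Prop where
  locallyFinite : IsLocallyFinite Λ
  periods : IsLattice (AddAction.stabilizer G Λ)

end Group

/-! ### Cut-and-project schemes -/

/-- A cut-and-project scheme `(G, H, 𝓛)`: a lattice `𝓛` in `G × H` on which the projection to `G` is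
injective and whose projection to `H` is dense. -/
structure CPS (G H : Type*) [AddCommGroup G] [TopologicalSpace G]
    [AddCommGroup H] [TopologicalSpace H] where
  lattice : AddSubgroup (G × H)
  isLattice : IsLattice lattice
  fst_injOn : ∀ y : H, ((0 : G), y) ∈ lattice → y = 0
  snd_dense : Dense (Prod.snd '' (lattice : Set (G × H)))

namespace CPS

section Star

variable {G H : Type*} [AddCommGroup G] [TopologicalSpace G] [AddCommGroup H] [TopologicalSpace H]

/-- The projection `L` of the lattice to `G`. -/
def L (S : CPS G H) : AddSubgroup G := S.lattice.map (AddMonoidHom.fst G H)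

theorem exists_star (S : CPS G H) (x : S.L) : ∃ y : H, ((x : G), y) ∈ S.lattice := by
  obtain ⟨⟨a, b⟩, h, hx⟩ := x.2
  exact ⟨b, by rw [← hx]; exact h⟩

/-- The star map: `star x` is the unique `y` with `(x, y)` in the lattice. -/
def star (S : CPS G H) (x : S.L) : H := (S.exists_star x).choose

theorem star_spec (S : CPS G H) (x : S.L) : ((x : G), S.star x) ∈ S.lattice :=
  (S.exists_star x).choose_spec

/-- The set `⋏(W) = {x ∈ L | star x ∈ W}`. -/
def project (S : CPS G H) (W : Set H) : Set G := {x | ∃ ℓ : S.L, (ℓ : G) = x ∧ S.star ℓ ∈ W}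

/-- `Λ` is a model set in the scheme: `Λ = ⋏(W)` for some relatively compact window `W` with
nonempty interior. -/
def IsModelSet (S : CPS G H) (Λ : Set G) : Prop :=
  ∃ W : Set H, IsCompact (closure W) ∧ (interior W).Nonempty ∧ Λ = S.project W

end Star

section Deformed

variable {G H : Type*} [AddCommGroup G] [TopologicalSpace G] [IsTopologicalAddGroup G]
  [T2Space G] [AddCommGroup H] [TopologicalSpace H] [IsTopologicalAddGroup H] [T2Space H]

theorem finite_deformed (S : CPS G H) (f : C_c(H, ℂ)) (p : C(H, G)) (K : Set G)
    (hK : IsCompact K) :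
    {ℓ : S.L | f (S.star ℓ) ≠ 0 ∧ (ℓ : G) + p (S.star ℓ) ∈ K}.Finite := by
  have hW : IsCompact (tsupport f) := f.hasCompactSupport
  have hQ : IsCompact ((K - p '' tsupport f) ×ˢ tsupport f) :=
    (isCompact_sub hK (hW.image p.continuous)).prod hW
  let _ := IsTopologicalAddGroup.rightUniformSpace (G × H)
  have : IsUniformAddGroup (G × H) := isUniformAddGroup_of_addCommGroup
  have hd := S.isLattice.discrete
  have hc : IsClosed (S.lattice : Set (G × H)) := AddSubgroup.isClosed_of_discrete
  have hcpt : IsCompact ((↑) ⁻¹' ((K - p '' tsupport f) ×ˢ tsupport f) : Set S.lattice) :=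
    hc.isClosedEmbedding_subtypeVal.isCompact_preimage hQ
  have hfin := hcpt.finite_of_discrete
  refine Set.Finite.of_finite_image (f := fun ℓ : S.L => (⟨_, S.star_spec ℓ⟩ : S.lattice))
    (hfin.subset ?_) ?_
  · rintro _ ⟨ℓ, ⟨h1, h2⟩, rfl⟩
    have h3 : S.star ℓ ∈ tsupport f := subset_tsupport _ h1
    exact ⟨⟨_, h2, _, ⟨_, h3, rfl⟩, add_sub_cancel_right _ _⟩, h3⟩
  · intro a _ b _ hab
    have := congrArg (fun z : S.lattice => z.1.1) hab
    exact Subtype.ext this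

/-- The deformed weighted model set `∑ ℓ ∈ L, f (star ℓ) • δ_(ℓ + p (star ℓ))` with weight function
`f` and deformation function `p`. -/
def deformedWeighted (S : CPS G H) (f : C_c(H, ℂ)) (p : C(H, G)) : RadonMeasure G :=
  weightedComb (fun ℓ : S.L => f (S.star ℓ)) (fun ℓ => (ℓ : G) + p (S.star ℓ))
    (S.finite_deformed f p)

/-- The class of all deformed weighted model sets in the scheme. -/
def deformedWeightedModelSets (S : CPS G H) : Set (RadonMeasure G) :=
  {μ | ∃ (f : C_c(H, ℂ)) (p : C(H, G)), μ = S.deformedWeighted f p}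

/-- The deformed weighted variants of a model set `Λ` in the scheme: the deformed weighted model
sets all of whose points of nonzero weight are deformations of points of `Λ`, i.e. the measures
`∑ ℓ ∈ Λ, f (star ℓ) • δ_(ℓ + p (star ℓ))`. -/
def deformedWeightedVariants (S : CPS G H) (Λ : Set G) : Set (RadonMeasure G) :=
  {μ | ∃ (f : C_c(H, ℂ)) (p : C(H, G)),
    (∀ ℓ : S.L, (ℓ : G) ∉ Λ → f (S.star ℓ) = 0) ∧ μ = S.deformedWeighted f p}

end Deformed

end CPS

/-! ### The Bohr compactification -/

/-- The Pontryagin dual of `G`, to be equipped with the discrete topology. -/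
def DiscreteDual (G : Type*) [AddCommGroup G] [TopologicalSpace G] : Type _ :=
  PontryaginDual (Multiplicative G)

instance (G : Type*) [AddCommGroup G] [TopologicalSpace G] : CommGroup (DiscreteDual G) :=
  inferInstanceAs (CommGroup (PontryaginDual (Multiplicative G)))

instance (G : Type*) [AddCommGroup G] [TopologicalSpace G] : TopologicalSpace (DiscreteDual G) := ⊥

instance (G : Type*) [AddCommGroup G] [TopologicalSpace G] : DiscreteTopology (DiscreteDual G) :=
  ⟨rfl⟩

/-- The Bohr compactification of `G`: the dual of the dual group of `G` with discrete topology,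
written additively. -/
abbrev Bohr (G : Type*) [AddCommGroup G] [TopologicalSpace G] : Type _ :=
  Additive (PontryaginDual (DiscreteDual G))

instance (G : Type*) [AddCommGroup G] [TopologicalSpace G] : T2Space (Bohr G) :=
  inferInstanceAs (T2Space (PontryaginDual (DiscreteDual G)))

/-- The canonical homomorphism `i_b : G → G_b`, evaluating characters at points. -/
def toBohr (G : Type*) [AddCommGroup G] [TopologicalSpace G] : G →+ Bohr G where
  toFun := fun x => Additive.ofMul
    (ContinuousMonoidHom.mk
      { toFun := fun χ => (show PontryaginDual (Multiplicative G) from χ) (Multiplicative.ofAdd x)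
        map_one' := rfl
        map_mul' := fun _ _ => rfl }
      continuous_of_discreteTopology)
  map_zero' := by
    apply Additive.toMul.injective
    ext χ
    exact congrArg _ (map_one (show PontryaginDual (Multiplicative G) from χ))
  map_add' := fun x y => by
    apply Additive.toMul.injective
    ext χ
    exact congrArg _ (map_mul (show PontryaginDual (Multiplicative G) from χ)
      (Multiplicative.ofAdd x) (Multiplicative.ofAdd y))

/-! ### The extended cut-and-project scheme -/

namespace CPS

section Ext

variable {G H : Type*} [AddCommGroup G] [TopologicalSpace G]
  [AddCommGroup H] [TopologicalSpace H] [IsTopologicalAddGroup H]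

/-- The subgroup `{(ℓ, (star ℓ, i_b ℓ)) | ℓ ∈ L}` of `G × (H × G_b)`. -/
def preExtLattice (S : CPS G H) : AddSubgroup (G × (H × Bohr G)) :=
  S.lattice.map ((AddMonoidHom.fst G H).prod
    ((AddMonoidHom.snd G H).prod ((toBohr G).comp (AddMonoidHom.fst G H))))

/-- The internal space of the extended scheme: the closure in `H × G_b` of the projection
`{(star ℓ, i_b ℓ) | ℓ ∈ L}`. -/
def extSpace (S : CPS G H) : AddSubgroup (H × Bohr G) :=
  (S.preExtLattice.map (AddMonoidHom.snd G (H × Bohr G))).topologicalClosure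

/-- The lattice `{(ℓ, (star ℓ, i_b ℓ)) | ℓ ∈ L}` of the extended scheme, as a subgroup of
`G × extSpace`. -/
def extLattice (S : CPS G H) : AddSubgroup (G × S.extSpace) :=
  S.preExtLattice.comap ((AddMonoidHom.id G).prodMap S.extSpace.subtype)

theorem mem_extLattice (S : CPS G H) (z : G × S.extSpace) :
    z ∈ S.extLattice ↔ (z.1, (z.2 : H × Bohr G).1) ∈ S.lattice ∧
      (z.2 : H × Bohr G).2 = toBohr G z.1 := by
  constructor
  · rintro ⟨⟨a, b⟩, h, hz⟩
    have h1 : a = z.1 := congrArg Prod.fst hz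
    have h2 : b = (z.2 : H × Bohr G).1 := congrArg (fun t => t.2.1) hz
    have h3 : toBohr G a = (z.2 : H × Bohr G).2 := congrArg (fun t => t.2.2) hz
    subst h1 h2
    exact ⟨h, h3.symm⟩
  · rintro ⟨h1, h2⟩
    exact ⟨(z.1, (z.2 : H × Bohr G).1), h1, Prod.ext rfl (Prod.ext rfl h2.symm)⟩

theorem isClosed_extSpace (S : CPS G H) : IsClosed (S.extSpace : Set (H × Bohr G)) :=
  AddSubgroup.isClosed_topologicalClosure _

theorem mem_extSpace (S : CPS G H) {x : G} {y : H} (h : (x, y) ∈ S.lattice) :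
    (y, toBohr G x) ∈ S.extSpace :=
  subset_closure ⟨(x, (y, toBohr G x)), ⟨(x, y), h, rfl⟩, rfl⟩

instance (S : CPS G H) [T2Space H] : T2Space S.extSpace :=
  inferInstanceAs (T2Space (S.extSpace : Set (H × Bohr G)))

instance (S : CPS G H) [LocallyCompactSpace H] : LocallyCompactSpace S.extSpace :=
  S.isClosed_extSpace.locallyCompactSpace

/-- The extended cut-and-project scheme. -/
def extend (S : CPS G H) : CPS G S.extSpace where
  lattice := S.extLattice
  isLattice :=
    { discrete := by
        have := S.isLattice.discrete
        let j : S.extLattice → S.lattice := fun z =>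
          ⟨(z.1.1, (z.1.2 : H × Bohr G).1), ((S.mem_extLattice z.1).1 z.2).1⟩
        have hj : Continuous j := by
          refine Continuous.subtype_mk ?_ _
          fun_prop
        refine DiscreteTopology.of_continuous_injective hj fun a b hab => ?_
        have h1 : a.1.1 = b.1.1 := congrArg (fun z => z.1.1) hab
        have h2 : (a.1.2 : H × Bohr G).1 = (b.1.2 : H × Bohr G).1 :=
          congrArg (fun z => z.1.2) hab
        refine Subtype.ext (Prod.ext h1 (Subtype.ext (Prod.ext h2 ?_)))
        rw [((S.mem_extLattice a.1).1 a.2).2, ((S.mem_extLattice b.1).1 b.2).2, h1]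
      cocompact := by
        obtain ⟨K, hK, hKu⟩ := S.isLattice.cocompact
        let e : G × S.extSpace → (G × H) × Bohr G := fun z =>
          ((z.1, (z.2 : H × Bohr G).1), (z.2 : H × Bohr G).2)
        have he : IsClosedEmbedding e :=
          (Homeomorph.prodAssoc G H (Bohr G)).symm.isClosedEmbedding.comp
            (IsClosedEmbedding.id.prodMap S.isClosed_extSpace.isClosedEmbedding_subtypeVal)
        refine ⟨e ⁻¹' (K ×ˢ univ), he.isCompact_preimage (hK.prod isCompact_univ), ?_⟩
        refine eq_univ_of_forall fun z => ?_
        obtain ⟨⟨x, y⟩, hxy, k, hk, hz⟩ :=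
          (hKu ▸ mem_univ (z.1, (z.2 : H × Bohr G).1) :
            (z.1, (z.2 : H × Bohr G).1) ∈ (S.lattice : Set (G × H)) + K)
        let l : G × S.extSpace := (x, ⟨(y, toBohr G x), S.mem_extSpace hxy⟩)
        refine ⟨l, (S.mem_extLattice l).2 ⟨hxy, rfl⟩, z - l, ?_, add_sub_cancel _ _⟩
        refine ⟨?_, mem_univ _⟩
        have : (e (z - l)).1 = k := by
          have h1 : x + k.1 = z.1 := congrArg Prod.fst hz
          have h2 : y + k.2 = (z.2 : H × Bohr G).1 := congrArg Prod.snd hz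
          refine Prod.ext ?_ ?_
          · exact sub_eq_iff_eq_add'.2 h1.symm
          · exact sub_eq_iff_eq_add'.2 h2.symm
        rw [this]
        exact hk }
  fst_injOn := fun y hy => by
    obtain ⟨h1, h2⟩ := (S.mem_extLattice _).1 hy
    exact Subtype.ext (Prod.ext (S.fst_injOn _ h1) (h2.trans (map_zero _)))
  snd_dense := fun y => by
    rw [closure_subtype]
    refine closure_mono ?_ y.2
    rintro _ ⟨_, ⟨⟨a, b⟩, h, rfl⟩, rfl⟩
    exact ⟨⟨(b, toBohr G a), S.mem_extSpace h⟩,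
      ⟨(a, ⟨(b, toBohr G a), S.mem_extSpace h⟩), (S.mem_extLattice _).2 ⟨h, rfl⟩, rfl⟩, rfl⟩

end Ext

end CPS
end CutProject

end

/-!
Everything rests on one fact: a function on `G` is almost periodic if and only if it is the
restriction of a continuous function on the closure `bohrHull G` of `G` in its Bohr
compactification (`isAlmostPeriodic_iff`). For the nontrivial direction, the almost periods of `f`
are the zero neighbourhoods of a totally bounded group topology on `G`, so `G` maps to the compact
completion `K`. Since the continuous characters of `K` separate its points
(`exists_continuous_character_ne_one`) and pull back to characters of `G`, Bohr-small elements are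
almost periods (`IsAlmostPeriodic.eventually_bohr`). Separation of points is proved with Gelfand
duality: on `L²(K)`, the translations and the convolution with a symmetric bump function commute,
and a Gelfand character of the commutative C⋆-algebra they generate, restricted to the
translations, is a character of `K`.

The internal space `H` of the extended scheme projects to `bohrHull G`, and the projection sends
the star of `ℓ` to the Bohr image of `ℓ`. Hence modulation functions extend along the star map to
continuous functions on `H`, even when they are evaluated at points `ℓ + p (star ℓ)`, whose Bohr
image is that of `ℓ` plus that of `p (star ℓ)`. This makes the class of deformed weighted model
sets modulation stable (`isModulationStable_deformedWeightedModelSets`). A modulation of a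
modulation is a modulation of the original measure, whatever that is
(`RadonMeasure.IsModulation.trans`), as almost periodic functions are stable under the operations
involved.

Let `P` be the period lattice of the ideal crystal `Λ`, which is a finite union of cosets of `P`.
The stars of `P` are relatively compact, and finitely many translates of their closure `C` cover a
set with nonempty interior, so `C` is a compact open subgroup of `H`. A lattice is closed in the
Bohr topology, by separation of points in the compact group `G ⧸ P`, so no other point of `L` has
its star in `C`. Therefore `Λ` has a compact open window
(`CPS.IsModelSet.exists_compact_open_window`). Multiplying the extended weight by the indicator
function of this window gives the deformed weighted variant that represents a given modulation.

Conversely, functions on `H` are almost periodic along `P` since `C` is compact, and smearing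
their values out with a bump function makes them almost periodic on `G`
(`CPS.IsModelSet.exists_isAlmostPeriodic_eq`). The smearing needs a real vector space as target,
hence the restriction to Euclidean `G`. The almost periodicity of these superpositions along `Λ`,
as well as that of `μ * φ` for modulations `μ` of `Λ`, is an instance of
`IsIdealCrystal.isAlmostPeriodic_finsum`.
-/

noncomputable section

namespace CutProject

set_option linter.unusedSectionVars false

section Characters

open MeasureTheory

/-! ### Characters of compact abelian groups -/

open StarAlgebra in
open scoped IsMulCommutative in
/-- By Gelfand duality, characters detect the nonzero elements of the C⋆-algebra generated by a
family of commuting normal elements. -/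
theorem exists_starAlgHom_apply_ne_zero {A : Type*} [CStarAlgebra A] {s : Set A}
    (hs : ∀ a ∈ s, ∀ b ∈ s, a * b = b * a) (hs' : ∀ a ∈ s, ∀ b ∈ s, a * star b = star b * a)
    (x : (adjoin ℂ s).topologicalClosure) (hx : x ≠ 0) :
    ∃ φ : (adjoin ℂ s).topologicalClosure →⋆ₐ[ℂ] ℂ, Continuous φ ∧ φ x ≠ 0 := by
  have hc := isMulCommutative_adjoin ℂ hs hs'
  let _ : CommRing (adjoin ℂ s).topologicalClosure :=
    StarSubalgebra.commRingTopologicalClosure (adjoin ℂ s) mul_comm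
  let _ : NormedCommRing (adjoin ℂ s).topologicalClosure :=
    { SubringClass.toNormedRing (adjoin ℂ s).topologicalClosure with mul_comm := mul_comm }
  have : CompleteSpace (adjoin ℂ s).topologicalClosure :=
    (isClosed_closure (s := (adjoin ℂ s : Set A))).completeSpace_coe
  let _ : CommCStarAlgebra (adjoin ℂ s).topologicalClosure := { }
  have h0 : gelfandStarTransform _ x ≠ 0 := by
    rwa [Ne, EmbeddingLike.map_eq_zero_iff]
  obtain ⟨φ, hφ⟩ := DFunLike.ne_iff.1 h0
  exact ⟨(φ : _ →⋆ₐ[ℂ] ℂ), map_continuous φ, hφ⟩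

section Compact

variable {K : Type*} [AddCommGroup K] [TopologicalSpace K] [IsTopologicalAddGroup K]
  [CompactSpace K] [T2Space K] [MeasurableSpace K] [BorelSpace K]
  (μ : Measure K) [μ.Regular] [μ.IsAddRightInvariant]

/-- Translation by `t` as a linear isometry of `L²(K)`. -/
def translationL2 (t : K) : Lp ℂ 2 μ →ₗᵢ[ℂ] Lp ℂ 2 μ :=
  Lp.compMeasurePreservingₗᵢ ℂ (· + t) (measurePreserving_add_right μ t)

theorem translationL2_toLp (t : K) (g : C(K, ℂ)) :
    translationL2 μ t (ContinuousMap.toLp 2 μ ℂ g) =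
      ContinuousMap.toLp 2 μ ℂ (g.comp (ContinuousMap.addRight t)) := rfl

theorem denseRange_toLp :
    DenseRange (ContinuousMap.toLp (E := ℂ) 2 μ ℂ) :=
  ContinuousMap.toLp_denseRange ℂ μ ℂ (by simp)

theorem translationL2_add (s t : K) (g : Lp ℂ 2 μ) :
    translationL2 μ (s + t) g = translationL2 μ s (translationL2 μ t g) := by
  refine (denseRange_toLp μ).induction_on g (isClosed_eq ?_ ?_) fun g => ?_
  · fun_prop
  · fun_prop
  simp only [translationL2_toLp]
  congr 1
  ext x
  simp [add_assoc]

theorem translationL2_zero (g : Lp ℂ 2 μ) :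
    translationL2 μ 0 g = g := by
  refine (denseRange_toLp μ).induction_on g (isClosed_eq ?_ ?_) fun g => ?_
  · fun_prop
  · fun_prop
  simp only [translationL2_toLp]
  congr 1
  ext x
  simp

/-- For a continuous kernel `Φ : K → L²(K)`, the map from `L²(K)` to `C(K)` sending `g` to
`x ↦ ⟪Φ x, g⟫`. -/
def kernelMap (Φ : C(K, Lp ℂ 2 μ)) : Lp ℂ 2 μ →L[ℂ] C(K, ℂ) :=
  LinearMap.mkContinuous
    { toFun := fun g => ⟨fun x => inner ℂ (Φ x) g, by fun_prop⟩
      map_add' := fun g h => ContinuousMap.ext fun x => inner_add_right (Φ x) g h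
      map_smul' := fun c g => ContinuousMap.ext fun x => inner_smul_right (Φ x) g c }
    ‖Φ‖ fun g => by
    refine (ContinuousMap.norm_le _ (by positivity)).2 fun x => ?_
    exact (norm_inner_le_norm (Φ x) g).trans (by gcongr; exact Φ.norm_coe_le_norm x)

/-- The integral operator on `L²(K)` with the continuous kernel `Φ : K → L²(K)`. -/
def kernelOp (Φ : C(K, Lp ℂ 2 μ)) : Lp ℂ 2 μ →L[ℂ] Lp ℂ 2 μ :=
  (ContinuousMap.toLp 2 μ ℂ).comp (kernelMap μ Φ)

theorem kernelOp_apply (Φ : C(K, Lp ℂ 2 μ)) (g : Lp ℂ 2 μ) :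
    kernelOp μ Φ g = ContinuousMap.toLp 2 μ ℂ (kernelMap μ Φ g) := rfl

theorem kernelOp_sub (Φ Ψ : C(K, Lp ℂ 2 μ)) :
    kernelOp μ (Φ - Ψ) = kernelOp μ Φ - kernelOp μ Ψ := by
  ext1 g
  rw [sub_apply, kernelOp_apply, kernelOp_apply, kernelOp_apply, ← map_sub]
  congr 1
  ext x
  exact inner_sub_left (Φ x) (Ψ x) g

theorem norm_kernelOp_le (Φ : C(K, Lp ℂ 2 μ)) :
    ‖kernelOp μ Φ‖ ≤ ‖ContinuousMap.toLp (E := ℂ) 2 μ ℂ‖ * ‖Φ‖ := by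
  have h : ‖kernelMap μ Φ‖ ≤ ‖Φ‖ := LinearMap.mkContinuous_norm_le _ (norm_nonneg _) _
  refine (ContinuousLinearMap.opNorm_comp_le _ _).trans ?_
  gcongr

theorem continuous_kernelOp : Continuous (kernelOp μ : C(K, Lp ℂ 2 μ) → _) := by
  refine (LipschitzWith.of_dist_le_mul (K := ‖ContinuousMap.toLp (E := ℂ) 2 μ ℂ‖₊)
    fun Φ Ψ => ?_).continuous
  rw [dist_eq_norm, dist_eq_norm, ← kernelOp_sub]
  exact norm_kernelOp_le μ _

/-- The kernel of convolution with `f`: `x ↦ conj (f (x - ·))`. -/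
def convKernel (f : C(K, ℂ)) : C(K, Lp ℂ 2 μ) :=
  (ContinuousMap.toLp (E := ℂ) 2 μ ℂ : C(C(K, ℂ), Lp ℂ 2 μ)).comp
    (ContinuousMap.curry ⟨fun z : K × K => star (f (z.1 - z.2)), by fun_prop⟩)

theorem convKernel_apply (f : C(K, ℂ)) (x : K) :
    convKernel μ f x = ContinuousMap.toLp 2 μ ℂ ⟨fun y => star (f (x - y)), by fun_prop⟩ := rfl

/-- On continuous functions, the operator with kernel `convKernel μ f` is convolution with `f`. -/
theorem kernelOp_convKernel_toLp (f g : C(K, ℂ)) :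
    ∃ h : C(K, ℂ), (∀ x, h x = ∫ y, g y * f (x - y) ∂μ) ∧
      kernelOp μ (convKernel μ f) (ContinuousMap.toLp 2 μ ℂ g) = ContinuousMap.toLp 2 μ ℂ h := by
  refine ⟨_, fun x => ?_, kernelOp_apply μ _ _⟩
  refine (ContinuousMap.inner_toLp μ _ g).trans ?_
  simp

theorem kernelOp_comp_addRight (f : C(K, ℂ)) (t : K) :
    (translationL2 μ t).toContinuousLinearMap * kernelOp μ (convKernel μ f) =
      kernelOp μ ((convKernel μ f).comp (ContinuousMap.addRight t)) := by
  ext1 g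
  rfl

theorem kernelOp_mul_translation (f : C(K, ℂ)) (t : K) :
    kernelOp μ (convKernel μ f) * (translationL2 μ t).toContinuousLinearMap =
      (translationL2 μ t).toContinuousLinearMap * kernelOp μ (convKernel μ f) := by
  rw [kernelOp_comp_addRight]
  ext1 g
  change kernelOp μ _ (translationL2 μ t g) = _
  rw [kernelOp_apply, kernelOp_apply]
  congr 1
  ext x
  change inner ℂ (convKernel μ f x) (translationL2 μ t g) = inner ℂ (convKernel μ f (x + t)) g
  have : convKernel μ f x = translationL2 μ t (convKernel μ f (x + t)) := by
    rw [convKernel_apply, convKernel_apply, translationL2_toLp]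
    congr 1
    ext y
    simp
  rw [this, LinearIsometry.inner_map_map]

theorem isSelfAdjoint_kernelOp_convKernel (f : C(K, ℂ))
    (hf : ∀ x, star (f x) = f (-x)) : IsSelfAdjoint (kernelOp μ (convKernel μ f)) := by
  rw [ContinuousLinearMap.isSelfAdjoint_iff_isSymmetric]
  intro g k
  change inner ℂ (kernelOp μ (convKernel μ f) g) k = inner ℂ g (kernelOp μ (convKernel μ f) k)
  refine (denseRange_toLp μ).induction_on₂ (p := fun g k =>
    inner ℂ (kernelOp μ (convKernel μ f) g) k = inner ℂ g (kernelOp μ (convKernel μ f) k))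
    (isClosed_eq ?_ ?_) (fun g k => ?_) g k
  · fun_prop
  · fun_prop
  obtain ⟨a, ha, ha'⟩ := kernelOp_convKernel_toLp μ f g
  obtain ⟨b, hb, hb'⟩ := kernelOp_convKernel_toLp μ f k
  rw [ha', hb', ContinuousMap.inner_toLp, ContinuousMap.inner_toLp]
  simp only [ha, hb, ← integral_conj, ← integral_const_mul, ← integral_mul_const, map_mul]
  rw [integral_integral_swap_of_hasCompactSupport]
  · congr! 4 with x y
    -- after exchanging the integrals, the two integrands agree by the symmetry of `f`
    have := hf (y - x)
    rw [neg_sub] at this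
    rw [← this]
    simp
    ring
  · fun_prop
  · exact HasCompactSupport.of_compactSpace _

theorem continuous_translation_mul_kernelOp (f : C(K, ℂ)) :
    Continuous fun t => (translationL2 μ t).toContinuousLinearMap *
      kernelOp μ (convKernel μ f) := by
  simp only [kernelOp_comp_addRight]
  refine (continuous_kernelOp μ).comp ?_
  exact (ContinuousMap.curry
    ⟨fun z : K × K => convKernel μ f (z.2 + z.1), by fun_prop⟩).continuous

theorem translationL2_mul (s t : K) :
    (translationL2 μ s).toContinuousLinearMap * (translationL2 μ t).toContinuousLinearMap =
      (translationL2 μ (s + t)).toContinuousLinearMap :=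
  ContinuousLinearMap.ext fun g => (translationL2_add μ s t g).symm

theorem star_translationL2 (t : K) :
    star (translationL2 μ t).toContinuousLinearMap =
      (translationL2 μ (-t)).toContinuousLinearMap := by
  rw [ContinuousLinearMap.star_eq_adjoint, eq_comm, ContinuousLinearMap.eq_adjoint_iff]
  intro g k
  change inner ℂ (translationL2 μ (-t) g) k = inner ℂ g (translationL2 μ t k)
  rw [← (translationL2 μ t).inner_map_map, ← translationL2_add, add_neg_cancel,
    translationL2_zero]

/-- A symmetric bump function at zero whose support is disjoint from its translate by `a`. -/
theorem exists_symmetric_bump (a : K) (ha : a ≠ 0) :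
    ∃ f : C(K, ℝ), (∀ x, f (-x) = f x) ∧ f 0 ≠ 0 ∧ ∀ y, f y * f (a + y) = 0 := by
  obtain ⟨N, hN, hN'⟩ : ∃ N ∈ 𝓝 (0 : K), ∀ x ∈ N, ∀ y ∈ N, x - y ≠ a := by
    have : ∀ᶠ z : K × K in 𝓝 (0, 0), z.1 - z.2 ≠ a := by
      have hc : Continuous fun z : K × K => z.1 - z.2 := by fun_prop
      refine hc.continuousAt.eventually_ne ?_
      simpa using ha.symm
    rw [nhds_prod_eq] at this
    obtain ⟨N, hN, h⟩ := Filter.eventually_prod_self_iff (r := fun x y => x - y ≠ a) |>.1 this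
    exact ⟨N, hN, fun x hx y hy => h x hx y hy⟩
  let N' := interior (N ∩ -N)
  have hN0 : (0 : K) ∈ N' := mem_interior_iff_mem_nhds.2
    (Filter.inter_mem hN (neg_mem_nhds_zero K hN))
  obtain ⟨f, hf0, hf1, -⟩ := exists_continuous_zero_one_of_isClosed
    (isOpen_interior (s := N ∩ -N)).isClosed_compl (isClosed_singleton (x := (0 : K)))
    (Set.disjoint_singleton_right.2 fun h => h hN0)
  have hs : ∀ x, f x + f (-x) ≠ 0 → x ∈ N := by
    intro x hx
    by_contra hxN
    refine hx ?_
    rw [hf0, hf0]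
    · simp
    · exact fun h => hxN (by simpa using (interior_subset h).2)
    · exact fun h => hxN (interior_subset h).1
  refine ⟨⟨fun x => f x + f (-x), by fun_prop⟩, fun x => by simp [add_comm],
    by simp [hf1 rfl], fun y => ?_⟩
  by_contra h
  exact hN' (a + y) (hs _ (right_ne_zero_of_mul h)) y (hs _ (left_ne_zero_of_mul h)) (by simp)

end Compact

open StarAlgebra in
/-- A unitary representation `U` of an abelian group in a C⋆-algebra and a commuting self-adjoint
`T` with `t ↦ U t * T` norm continuous generate a commutative C⋆-algebra. If `U a * T ≠ T`, then
one of its Gelfand characters restricts to a continuous character of the group with value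
`≠ 1` at `a`. -/
theorem exists_character_of_commuting {K A : Type*} [AddCommGroup K] [TopologicalSpace K]
    [CStarAlgebra A] {T : A} {U : K → A} (hT : star T = T) (hU : ∀ s t, U s * U t = U (s + t))
    (hUs : ∀ t, star (U t) = U (-t)) (hU0 : U 0 = 1) (hTU : ∀ t, T * U t = U t * T)
    (hc : Continuous fun t => U t * T) {a : K} (hne : U a * T ≠ T) :
    ∃ χ : K → Circle, Continuous χ ∧ (∀ x y, χ (x + y) = χ x * χ y) ∧ χ a ≠ 1 := by
  let s : Set A := insert T (Set.range U)
  have hs : ∀ a ∈ s, ∀ b ∈ s, a * b = b * a := by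
    rintro _ (rfl | ⟨x, rfl⟩) _ (rfl | ⟨y, rfl⟩)
    · rfl
    · exact hTU y
    · exact (hTU x).symm
    · rw [hU, hU, add_comm]
  have hs' : ∀ a ∈ s, ∀ b ∈ s, a * star b = star b * a := by
    rintro c hc _ (rfl | ⟨y, rfl⟩)
    · rw [hT]
      exact hs _ hc _ (Set.mem_insert _ _)
    · rw [hUs]
      exact hs _ hc _ (Or.inr ⟨_, rfl⟩)
  have hmem (c) (hc : c ∈ s) : c ∈ (adjoin ℂ s).topologicalClosure :=
    subset_closure (subset_adjoin ℂ s hc)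
  let T' : (adjoin ℂ s).topologicalClosure := ⟨T, hmem _ (Or.inl rfl)⟩
  let U' : K → (adjoin ℂ s).topologicalClosure := fun t => ⟨U t, hmem _ (Or.inr ⟨t, rfl⟩)⟩
  obtain ⟨φ, hφ, hφne⟩ := exists_starAlgHom_apply_ne_zero hs hs' (U' a * T' - T')
    fun h => hne (sub_eq_zero.1 (congrArg Subtype.val h))
  have hmul (x y) : φ (U' (x + y)) = φ (U' x) * φ (U' y) := by
    rw [← map_mul]
    exact congrArg φ (Subtype.ext (hU x y).symm)
  have hnorm (x) : ‖φ (U' x)‖ = 1 := by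
    have h1 : φ (U' x) * star (φ (U' x)) = 1 := by
      rw [← map_star, ← map_mul, ← map_one φ]
      refine congrArg φ (Subtype.ext ?_)
      change U x * star (U x) = 1
      rw [hUs, hU, add_neg_cancel, hU0]
    have h2 : ‖φ (U' x)‖ * ‖φ (U' x)‖ = 1 := by
      simpa using congrArg norm h1
    nlinarith [norm_nonneg (φ (U' x))]
  have hφT : φ T' ≠ 0 := by
    intro h
    rw [map_sub, map_mul, h, mul_zero, sub_zero] at hφne
    exact hφne rfl
  -- `U` itself need not be norm continuous, so continuity is tested on `U t * T`
  have hcont : Continuous fun t => φ (U' t) := by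
    have h2 : Continuous fun t => U' t * T' := Continuous.subtype_mk hc _
    have h3 : (fun t => φ (U' t)) = fun t => φ (U' t * T') / φ T' := by
      ext1 t
      rw [map_mul, mul_div_cancel_right₀ _ hφT]
    rw [h3]
    exact (hφ.comp h2).div_const _
  refine ⟨fun t => ⟨φ (U' t), mem_sphere_zero_iff_norm.2 (hnorm t)⟩,
    hcont.subtype_mk _, fun x y => Subtype.ext (hmul x y), fun h => hφne ?_⟩
  rw [map_sub, map_mul, show φ (U' a) = 1 from congrArg Subtype.val h, one_mul, sub_self]

/-- Continuous characters separate the points of a compact abelian group. They are found in the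
C⋆-algebra on `L²(K)` that is generated by the translations and the convolution with a bump
function not fixed by the translation by `a`. -/
theorem exists_continuous_character_ne_one {K : Type*} [AddCommGroup K] [TopologicalSpace K]
    [IsTopologicalAddGroup K] [CompactSpace K] [T2Space K] {a : K} (ha : a ≠ 0) :
    ∃ χ : K → Circle, Continuous χ ∧ (∀ x y, χ (x + y) = χ x * χ y) ∧ χ a ≠ 1 := by
  let _ : MeasurableSpace K := borel K
  have : BorelSpace K := ⟨rfl⟩
  let μ : Measure K := Measure.addHaar
  obtain ⟨f, hfneg, hf, hfa⟩ := exists_symmetric_bump a ha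
  let F : C(K, ℂ) := ⟨fun x => (f x : ℂ), by fun_prop⟩
  refine exists_character_of_commuting (T := kernelOp μ (convKernel μ F))
    (U := fun t => (translationL2 μ t).toContinuousLinearMap)
    (isSelfAdjoint_kernelOp_convKernel μ F fun x => by simp [F, hfneg])
    (translationL2_mul μ) (star_translationL2 μ)
    (ContinuousLinearMap.ext fun g => translationL2_zero μ g)
    (kernelOp_mul_translation μ F) (continuous_translation_mul_kernelOp μ F) fun h => ?_
  obtain ⟨k, hk, hk'⟩ := kernelOp_convKernel_toLp μ F F
  have h1 := DFunLike.congr_fun h (ContinuousMap.toLp 2 μ ℂ F)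
  change translationL2 μ a (kernelOp μ (convKernel μ F) (ContinuousMap.toLp 2 μ ℂ F)) = _ at h1
  rw [hk', translationL2_toLp] at h1
  have h2 := DFunLike.congr_fun (ContinuousMap.toLp_injective μ h1) 0
  have h3 : k (0 + a) = k 0 := h2
  rw [hk, hk] at h3
  have h4 : ∀ x, F x = (f x : ℂ) := fun _ => rfl
  simp only [h4, ← Complex.ofReal_mul, integral_complex_ofReal, zero_sub, zero_add, hfneg] at h3
  -- the bump has support disjoint from its translate by `a`
  have h5 : ∀ y, f y * f (a - y) = 0 := fun y => by
    rw [← hfa (-y), hfneg, sub_eq_add_neg]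
  simp only [h5, integral_zero] at h3
  have h6 : 0 < ∫ y, f y * f y ∂μ :=
    (map_continuous f |>.mul (map_continuous f)).integral_pos_of_hasCompactSupport_nonneg_nonzero
      (HasCompactSupport.of_compactSpace _) (fun x => mul_self_nonneg _) (mul_self_ne_zero.2 hf)
  exact h6.ne (by exact_mod_cast h3)

end Characters

/-! ### The Bohr compactification and almost periodic functions -/

section Bohr

variable {G : Type*} [AddCommGroup G] [TopologicalSpace G]

theorem continuous_eval_bohr (χ : DiscreteDual G) :
    Continuous fun b : Bohr G => Additive.toMul b χ :=
  (continuous_eval_const (F := C(DiscreteDual G, Circle)) χ).comp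
    (ContinuousMonoidHom.isInducing_toContinuousMap (DiscreteDual G) Circle).continuous

theorem continuous_toBohr : Continuous (toBohr G) := by
  refine ContinuousMonoidHom.continuous_of_continuous_uncurry
    (fun x : G => (toBohr G x).toMul) ?_
  refine continuous_prod_of_discrete_right.2 fun χ => ?_
  exact (map_continuous (show PontryaginDual (Multiplicative G) from χ)).comp continuous_ofAdd

/-- A continuous additive character of `G` factors through the Bohr compactification. -/
theorem exists_bohr_lift {χ : G → Circle} (hχ : Continuous χ)
    (hadd : ∀ x y, χ (x + y) = χ x * χ y) :
    ∃ ψ : Bohr G → Circle, Continuous ψ ∧ (∀ x, ψ (toBohr G x) = χ x) ∧ ψ 0 = 1 := by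
  have h0 : χ 0 = 1 := by simpa using hadd 0 0
  let c : Multiplicative G →ₜ* Circle :=
    { toFun := fun x => χ x.toAdd
      map_one' := h0
      map_mul' := fun x y => hadd _ _
      continuous_toFun := hχ.comp continuous_toAdd }
  exact ⟨_, continuous_eval_bohr (show DiscreteDual G from c), fun x => rfl, rfl⟩

/-- A continuous homomorphism from `G` to a compact group is continuous at zero for the Bohr
topology of `G`: characters of the compact group separate its points, and they pull back to
characters of `G`. -/
theorem tendsto_comap_toBohr {K : Type*} [AddCommGroup K] [TopologicalSpace K]
    [IsTopologicalAddGroup K] [CompactSpace K] [T2Space K] (j : G →+ K) (hj : Continuous j) :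
    Filter.Tendsto j (Filter.comap (toBohr G) (𝓝 0)) (𝓝 0) := by
  refine le_nhds_of_unique_clusterPt fun a ha => ?_
  by_contra hne
  obtain ⟨χ, hχ, hadd, hχa⟩ := exists_continuous_character_ne_one hne
  obtain ⟨ψ, hψ, hψ', hψ0⟩ := exists_bohr_lift (hχ.comp hj)
    (fun x y => by simp only [Function.comp_apply, map_add, hadd])
  have h1 : Filter.Tendsto (χ ∘ j) (Filter.comap (toBohr G) (𝓝 0)) (𝓝 1) := by
    have : Filter.Tendsto ψ (𝓝 0) (𝓝 1) := hψ0 ▸ hψ.tendsto 0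
    refine (this.comp Filter.tendsto_comap).congr fun x => ?_
    exact hψ' x
  have h2 : ClusterPt (χ a) (Filter.map χ (Filter.map j (Filter.comap (toBohr G) (𝓝 0)))) :=
    ClusterPt.map ha hχ.continuousAt Filter.tendsto_map
  rw [Filter.map_map] at h2
  have : ClusterPt (χ a) (𝓝 1) := h2.mono h1
  exact hχa (eq_of_nhds_neBot this)

end Bohr

universe u in
/-- A totally bounded abelian group maps to its completion, a compact group that induces its
topology. -/
theorem exists_compact_of_totallyBounded {G : Type u} [AddCommGroup G] [TopologicalSpace G]
    [IsTopologicalAddGroup G] (h : ∀ N ∈ 𝓝 (0 : G), ∃ F : Set G, F.Finite ∧ F + N = univ) :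
    ∃ (K : Type u) (_ : AddCommGroup K) (_ : TopologicalSpace K) (_ : IsTopologicalAddGroup K)
      (_ : CompactSpace K) (_ : T2Space K) (j : G →+ K), IsInducing j := by
  let _ := IsTopologicalAddGroup.rightUniformSpace G
  have : IsUniformAddGroup G := isUniformAddGroup_of_addCommGroup
  refine ⟨UniformSpace.Completion G, inferInstance, inferInstance, inferInstance, ⟨?_⟩,
    inferInstance, UniformSpace.Completion.toCompl,
    (UniformSpace.Completion.isUniformInducing_coe G).isInducing⟩
  have h1 : TotallyBounded (univ : Set G) := by
    rw [totallyBounded_iff_subset_finite_iUnion_nhds_zero]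
    intro U hU
    obtain ⟨F, hF, hFU⟩ := h U hU
    refine ⟨F, hF, fun x _ => ?_⟩
    obtain ⟨a, ha, b, hb, hab⟩ := hFU.symm ▸ mem_univ x
    exact mem_biUnion ha ⟨b, hb, hab⟩
  have h2 := (h1.image (UniformSpace.Completion.uniformContinuous_coe G)).closure
  rw [image_univ, UniformSpace.Completion.denseRange_coe.closure_range] at h2
  exact isCompact_iff_totallyBounded_isComplete.2
    ⟨h2, completeSpace_iff_isComplete_univ.1 inferInstance⟩

/-- The `V`-almost periods of `f`. -/
def almostPeriods {G E : Type*} [AddCommGroup G] [AddCommGroup E] (f : G → E) (V : Set E) : Set G :=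
  {t | ∀ x, f (x - t) - f x ∈ V}

section AlmostPeriodic

variable {G E : Type*} [AddCommGroup G] [AddCommGroup E] {f : G → E}

theorem almostPeriods_mono {V W : Set E} (h : V ⊆ W) : almostPeriods f V ⊆ almostPeriods f W :=
  fun _ ht x => h (ht x)

theorem add_mem_almostPeriods {V W : Set E} {s t : G} (hs : s ∈ almostPeriods f V)
    (ht : t ∈ almostPeriods f W) : s + t ∈ almostPeriods f (V + W) := fun x =>
  ⟨_, hs (x - t), _, ht x, by
    dsimp only
    rw [sub_sub, add_comm t s, sub_add_sub_cancel]⟩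

theorem neg_mem_almostPeriods {V : Set E} {t : G} (ht : t ∈ almostPeriods f V) :
    -t ∈ almostPeriods f (-V) := fun x => by
  have := ht (x + t)
  rwa [add_sub_cancel_right, ← neg_sub, ← Set.mem_neg, ← sub_neg_eq_add] at this

variable [TopologicalSpace E] [IsTopologicalAddGroup E]

/-- The sets of almost periods of `f` form a zero neighbourhood basis of a group topology. -/
abbrev almostPeriodBasis (f : G → E) : AddGroupFilterBasis G where
  sets := almostPeriods f '' (𝓝 (0 : E)).sets
  nonempty := ⟨_, univ, Filter.univ_mem, rfl⟩
  inter_sets := by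
    rintro _ _ ⟨V, hV, rfl⟩ ⟨W, hW, rfl⟩
    exact ⟨_, ⟨V ∩ W, Filter.inter_mem hV hW, rfl⟩, subset_inter
      (almostPeriods_mono inter_subset_left) (almostPeriods_mono inter_subset_right)⟩
  zero' := by
    rintro _ ⟨V, hV, rfl⟩ x
    simpa using mem_of_mem_nhds hV
  add' := by
    rintro _ ⟨V, hV, rfl⟩
    obtain ⟨W, hW, hWV⟩ := exists_nhds_zero_half hV
    refine ⟨_, ⟨W, hW, rfl⟩, ?_⟩
    rintro _ ⟨s, hs, t, ht, rfl⟩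
    refine almostPeriods_mono ?_ (add_mem_almostPeriods hs ht)
    rintro _ ⟨a, ha, b, hb, rfl⟩
    exact hWV a ha b hb
  neg' := by
    rintro _ ⟨V, hV, rfl⟩
    refine ⟨_, ⟨-V, neg_mem_nhds_zero E hV, rfl⟩, fun t ht => ?_⟩
    simpa using neg_mem_almostPeriods ht
  conj' := by
    rintro x _ ⟨V, hV, rfl⟩
    exact ⟨_, ⟨V, hV, rfl⟩, fun t ht => by simpa using ht⟩

theorem hasBasis_nhds_almostPeriodBasis (f : G → E) :
    (@nhds G (almostPeriodBasis f).topology 0).HasBasis (fun V => V ∈ 𝓝 (0 : E))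
      (almostPeriods f) := by
  constructor
  intro N
  rw [AddGroupFilterBasis.nhds_zero_eq]
  constructor
  · rintro ⟨_, ⟨V, hV, rfl⟩, hVN⟩
    exact ⟨V, hV, hVN⟩
  · rintro ⟨V, hV, hVN⟩
    exact ⟨_, ⟨V, hV, rfl⟩, hVN⟩

variable [TopologicalSpace G] [IsTopologicalAddGroup G]

theorem IsAlmostPeriodic.almostPeriods_mem_nhds (hf : IsAlmostPeriodic f) {V : Set E}
    (hV : V ∈ 𝓝 0) : almostPeriods f V ∈ 𝓝 0 := by
  obtain ⟨U, hU, h⟩ := hf.uniformContinuous V hV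
  filter_upwards [neg_mem_nhds_zero G hU] with t ht x
  exact h _ _ (by simpa using ht)

/-- Finitely many translates of the `V`-almost periods cover `G`: by uniform continuity, the compact
set of translations may be replaced by a finite one. -/
theorem IsAlmostPeriodic.exists_finite_cover (hf : IsAlmostPeriodic f) {V : Set E}
    (hV : V ∈ 𝓝 0) : ∃ F : Set G, F.Finite ∧ F + almostPeriods f V = univ := by
  obtain ⟨W, hW, hWV⟩ := exists_nhds_zero_half hV
  obtain ⟨K, hK, hKu⟩ := hf.relativelyDense W hW
  obtain ⟨F, -, hF⟩ := hK.elim_nhds_subcover (fun x => x +ᵥ almostPeriods f W) fun x _ => by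
    simpa using vadd_mem_nhds_vadd x (hf.almostPeriods_mem_nhds hW)
  refine ⟨F, F.finite_toSet, eq_univ_of_forall fun x => ?_⟩
  obtain ⟨s, hs, k, hk, rfl⟩ := hKu.symm ▸ mem_univ x
  obtain ⟨y, hy, t, ht, rfl⟩ := mem_iUnion₂.1 (hF hk)
  refine ⟨y, hy, s + t, almostPeriods_mono ?_ (add_mem_almostPeriods hs ht), add_left_comm _ _ _⟩
  rintro _ ⟨a, ha, b, hb, rfl⟩
  exact hWV a ha b hb

/-- Bohr-small elements are almost periods: the almost periods are the zero neighbourhoods of a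
totally bounded group topology, and continuous homomorphisms to its compact completion are
continuous for the Bohr topology. -/
theorem IsAlmostPeriodic.eventually_bohr (hf : IsAlmostPeriodic f) {V : Set E} (hV : V ∈ 𝓝 0) :
    ∀ᶠ t in Filter.comap (toBohr G) (𝓝 0), ∀ x, f (x - t) - f x ∈ V := by
  obtain ⟨K, _, _, _, _, _, j, hj⟩ := @exists_compact_of_totallyBounded G _
    (almostPeriodBasis f).topology (almostPeriodBasis f).isTopologicalAddGroup (by
      intro N hN
      obtain ⟨V, hV, hVN⟩ := (hasBasis_nhds_almostPeriodBasis f).mem_iff.1 hN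
      obtain ⟨F, hF, hFV⟩ := hf.exists_finite_cover hV
      exact ⟨F, hF, eq_univ_of_univ_subset (hFV ▸ add_subset_add_left hVN)⟩)
  have hn : @nhds G (almostPeriodBasis f).topology 0 = Filter.comap j (𝓝 0) := by
    rw [← map_zero j]
    exact @IsInducing.nhds_eq_comap G K j _ (almostPeriodBasis f).topology hj 0
  have hjc : Continuous j := by
    refine continuous_of_continuousAt_zero j ?_
    rw [ContinuousAt, map_zero, Filter.tendsto_iff_comap, ← hn]
    intro N hN
    obtain ⟨V, hV, hVN⟩ := (hasBasis_nhds_almostPeriodBasis f).mem_iff.1 hN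
    exact Filter.mem_of_superset (hf.almostPeriods_mem_nhds hV) hVN
  have h1 := (hasBasis_nhds_almostPeriodBasis f).mem_of_mem hV
  rw [hn] at h1
  obtain ⟨N, hN, hNV⟩ := h1
  exact Filter.mem_of_superset (tendsto_comap_toBohr j hjc hN) hNV

end AlmostPeriodic

/-! ### The closure of the group in its Bohr compactification -/

section Hull

/-- The closure of the image of `G` in its Bohr compactification. By duality theory it is all of
`Bohr G`, but this is not needed here. -/
def bohrHull (G : Type*) [AddCommGroup G] [TopologicalSpace G] : AddSubgroup (Bohr G) :=
  (toBohr G).range.topologicalClosure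

/-- The canonical map from `G` to the closure of its image in the Bohr compactification. -/
def toHull (G : Type*) [AddCommGroup G] [TopologicalSpace G] : G →+ bohrHull G :=
  (toBohr G).codRestrict (bohrHull G) fun x => subset_closure ⟨x, rfl⟩

variable {G E : Type*} [AddCommGroup G] [TopologicalSpace G]

instance : CompactSpace (bohrHull G) :=
  isCompact_iff_compactSpace.1 (AddSubgroup.isClosed_topologicalClosure _).isCompact

instance : T2Space (bohrHull G) := inferInstanceAs (T2Space (bohrHull G : Set (Bohr G)))

theorem continuous_toHull : Continuous (toHull G) := continuous_toBohr.subtype_mk _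

theorem denseRange_toHull : DenseRange (toHull G) := by
  intro b
  rw [closure_subtype]
  refine closure_mono ?_ b.2
  rintro _ ⟨x, rfl⟩
  exact ⟨toHull G x, ⟨x, rfl⟩, rfl⟩

theorem comap_toHull : Filter.comap (toHull G) (𝓝 0) = Filter.comap (toBohr G) (𝓝 0) := by
  rw [nhds_subtype, Filter.comap_comap]
  rfl

/-- A map from a dense subset extends continuously if it has limits at all points. -/
theorem exists_continuous_extension {X Y Z : Type*} [TopologicalSpace Y] [TopologicalSpace Z]
    [T3Space Z] {i : X → Y} (hi : DenseRange i) {h : X → Z}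
    (hlim : ∀ b, ∃ c, Filter.Tendsto h (Filter.comap i (𝓝 b)) (𝓝 c)) :
    ∃ F : C(Y, Z), ∀ x, F (i x) = h x := by
  let _ : TopologicalSpace X := TopologicalSpace.induced i inferInstance
  have di : IsDenseInducing i := ⟨⟨rfl⟩, hi⟩
  refine ⟨⟨_, di.continuous_extend hlim⟩, fun x => ?_⟩
  obtain ⟨c, hc⟩ := hlim (i x)
  have h1 : h x = c := tendsto_nhds_unique (tendsto_pure_nhds h x)
    (hc.mono_left (Filter.pure_le_iff.2 fun s hs => by
      obtain ⟨u, hu, hus⟩ := hs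
      have h1 : i x ∈ u := mem_of_mem_nhds hu
      exact hus h1))
  exact (di.extend_eq_of_tendsto hc).trans h1.symm

variable [AddCommGroup E] [TopologicalSpace E] [IsTopologicalAddGroup E] [IsTopologicalAddGroup G]

/-- An almost periodic function extends continuously to the closure of `G` in its Bohr
compactification. -/
theorem IsAlmostPeriodic.exists_hull_extension [T2Space E] {f : G → E} (hf : IsAlmostPeriodic f) :
    ∃ F : C(bohrHull G, E), ∀ x, F (toHull G x) = f x := by
  refine exists_continuous_extension denseRange_toHull fun b => ?_
  have : (Filter.comap (toHull G) (𝓝 b)).NeBot :=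
    Filter.comap_neBot fun s hs => by
      obtain ⟨_, h, x, rfl⟩ := mem_closure_iff_nhds.1 (denseRange_toHull b) s hs
      exact ⟨x, h⟩
  have hcpt : IsCompact (closure (range f)) := hf.bounded
  -- `f` has a cluster point at `b` by compactness, which is a limit since `f` is Cauchy at `b`
  obtain ⟨c, -, hc⟩ := hcpt.exists_clusterPt
    (f := Filter.map f (Filter.comap (toHull G) (𝓝 b)))
    (Filter.le_principal_iff.2 (Filter.mem_map.2 (Filter.univ_mem' fun x =>
      (subset_closure (mem_range_self x) : f x ∈ closure (range f)))))
  refine ⟨c, ?_⟩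
  suffices h : Filter.Tendsto (fun x => f x - c) (Filter.comap (toHull G) (𝓝 b)) (𝓝 0) by
    simpa using h.add_const c
  intro V hV
  obtain ⟨W, hW, hWV⟩ := exists_nhds_zero_half hV
  have h1 := hf.eventually_bohr hW
  rw [← comap_toHull] at h1
  obtain ⟨N, hN, hNW⟩ := h1
  obtain ⟨N', hN', hNN⟩ := exists_nhds_half_neg hN
  have hM : {x | toHull G x - b ∈ N'} ∈ Filter.comap (toHull G) (𝓝 b) := by
    refine ⟨{y | y - b ∈ N'}, ?_, subset_rfl⟩
    have : Filter.Tendsto (fun y => y - b) (𝓝 b) (𝓝 0) := by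
      simpa using (continuous_id.sub continuous_const).tendsto (x := b) (f := fun y => y - b)
    exact this hN'
  have hcW : {y | y - c ∈ W} ∈ 𝓝 c := by
    have : Filter.Tendsto (fun y => y - c) (𝓝 c) (𝓝 0) := by
      simpa using (continuous_id.sub continuous_const).tendsto (x := c) (f := fun y => y - c)
    exact this hW
  obtain ⟨_, hyc, y, hy, rfl⟩ := clusterPt_iff_nonempty.1 hc hcW (Filter.image_mem_map hM)
  refine Filter.mem_map.2 (Filter.mem_of_superset hM fun x hx => ?_)
  have h2 : toHull G (y - x) ∈ N := by
    rw [map_sub, ← sub_sub_sub_cancel_right _ _ b]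
    exact hNN _ hy _ hx
  have h3 := hNW h2 y
  rw [sub_sub_cancel] at h3
  have := hWV _ h3 _ hyc
  rwa [sub_add_sub_cancel] at this

end Hull

/-- A continuous function is uniformly continuous near a compact set. -/
theorem eventually_add_sub_mem {H E : Type*} [AddCommGroup H] [TopologicalSpace H]
    [IsTopologicalAddGroup H] [AddCommGroup E] [TopologicalSpace E] [IsTopologicalAddGroup E]
    {p : H → E} (hp : Continuous p) {U : Set H} (hU : IsCompact U) {V : Set E} (hV : V ∈ 𝓝 0) :
    ∀ᶠ n in 𝓝 (0 : H), ∀ y ∈ U, p (y + n) - p y ∈ V := by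
  refine hU.eventually_forall_of_forall_eventually fun y _ => ?_
  have h : Continuous fun z : H × H => p (z.2 + z.1) - p z.2 := by fun_prop
  have := h.tendsto (0, y)
  simp only [add_zero, sub_self] at this
  exact this hV

/-- The return times of a relatively dense subgroup to a zero neighbourhood, under a homomorphism
with relatively compact range, are relatively dense. -/
theorem IsRelativelyDense.preimage_nhds {G H : Type*} [AddCommGroup G] [TopologicalSpace G]
    [IsTopologicalAddGroup G] [AddCommGroup H] [TopologicalSpace H] [IsTopologicalAddGroup H]
    {P : AddSubgroup G} (hP : IsRelativelyDense (P : Set G)) (j : P →+ H) {C : Set H}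
    (hC : IsCompact C) (hj : ∀ t, j t ∈ C) {N : Set H} (hN : N ∈ 𝓝 0) :
    IsRelativelyDense {t : G | ∃ h : t ∈ P, j ⟨t, h⟩ ∈ N} := by
  obtain ⟨N', hN', hNN⟩ := exists_nhds_half_neg hN
  obtain ⟨F, -, hF⟩ := hC.elim_nhds_subcover (fun x => x +ᵥ N') fun x _ => by
    simpa using vadd_mem_nhds_vadd x hN'
  -- in each translate `c + N'` that is visited, fix one visit `s c`; the differences of
  -- other visits to this translate from `s c` are in the return set of `N`
  have hch (c : H) : ∃ s : P, (∃ t, j t ∈ c +ᵥ N') → j s ∈ c +ᵥ N' := by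
    by_cases h : ∃ t, j t ∈ c +ᵥ N'
    · exact ⟨h.choose, fun _ => h.choose_spec⟩
    · exact ⟨0, fun h' => absurd h' h⟩
  choose s hs using hch
  obtain ⟨K, hK, hKu⟩ := hP
  refine ⟨(fun c => (s c : G)) '' F + K, (F.finite_toSet.image _).isCompact.add hK,
    eq_univ_of_forall fun x => ?_⟩
  obtain ⟨t, ht, k, hk, rfl⟩ := hKu.symm ▸ mem_univ x
  obtain ⟨c, hc, htc⟩ := mem_iUnion₂.1 (hF (hj ⟨t, ht⟩))
  obtain ⟨n, hn, hn'⟩ := htc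
  obtain ⟨m, hm, hm'⟩ := hs c ⟨_, ⟨n, hn, hn'⟩⟩
  refine ⟨t - s c, ⟨P.sub_mem ht (s c).2, ?_⟩, s c + k, ⟨_, ⟨c, hc, rfl⟩, k, hk, rfl⟩, ?_⟩
  · have h1 : j (⟨t, ht⟩ - s c) = n - m := by
      rw [map_sub, ← hn', ← hm']
      simp
    have h2 := hNN n hn m hm
    rw [← h1] at h2
    exact h2
  · dsimp only
    abel

section Hull

variable {G E : Type*} [AddCommGroup G] [TopologicalSpace G] [IsTopologicalAddGroup G]
  [AddCommGroup E] [TopologicalSpace E] [IsTopologicalAddGroup E] [T2Space E]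

theorem isRelativelyDense_univ : IsRelativelyDense ((⊤ : AddSubgroup G) : Set G) :=
  ⟨{0}, isCompact_singleton, by simp⟩

/-- Continuous functions on the closure of `G` in its Bohr compactification restrict to almost
periodic functions on `G`. -/
theorem isAlmostPeriodic_comp_toHull (F : C(bohrHull G, E)) :
    IsAlmostPeriodic fun x => F (toHull G x) where
  uniformContinuous := fun V hV => by
    have h := eventually_add_sub_mem F.continuous isCompact_univ hV
    rw [← map_zero (toHull G)] at h
    refine ⟨_, continuous_toHull.tendsto 0 h, fun x y hxy => ?_⟩
    simpa using hxy (toHull G y) trivial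
  bounded := (isCompact_range F.continuous).closure_of_subset
    (range_subset_iff.2 fun x => ⟨_, rfl⟩)
  relativelyDense := fun V hV => by
    have h := eventually_add_sub_mem F.continuous isCompact_univ hV
    have h' := (isRelativelyDense_univ (G := G)).preimage_nhds
      ((toHull G).comp (AddSubgroup.subtype ⊤)) isCompact_univ (fun _ => trivial)
      (neg_mem_nhds_zero _ h)
    obtain ⟨K, hK, hKu⟩ := h'
    refine ⟨K, hK, eq_univ_of_univ_subset (hKu ▸ add_subset_add_right ?_)⟩
    rintro t ⟨_, ht⟩ x
    simpa [sub_eq_add_neg] using ht (toHull G x) trivial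

/-- Almost periodic functions are the restrictions of the continuous functions on the closure of `G`
in its Bohr compactification. -/
theorem isAlmostPeriodic_iff {f : G → E} :
    IsAlmostPeriodic f ↔ ∃ F : C(bohrHull G, E), ∀ x, F (toHull G x) = f x := by
  refine ⟨fun hf => hf.exists_hull_extension, fun ⟨F, hF⟩ => ?_⟩
  rw [← funext hF]
  exact isAlmostPeriodic_comp_toHull F

end Hull

/-! ### The star map -/

namespace CPS

section Star

variable {G H : Type*} [AddCommGroup G] [TopologicalSpace G] [AddCommGroup H] [TopologicalSpace H]
  (T : CPS G H)

theorem eq_of_mem_lattice {x : G} {y z : H} (hy : (x, y) ∈ T.lattice) (hz : (x, z) ∈ T.lattice) :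
    y = z := by
  have := T.lattice.sub_mem hy hz
  rw [Prod.mk_sub_mk, sub_self] at this
  exact sub_eq_zero.1 (T.fst_injOn _ this)

theorem star_add (a b : T.L) : T.star (a + b) = T.star a + T.star b :=
  T.eq_of_mem_lattice (T.star_spec _) (T.lattice.add_mem (T.star_spec a) (T.star_spec b))

/-- The star map as a homomorphism. -/
def starHom : T.L →+ H := AddMonoidHom.mk' T.star T.star_add

@[simp] theorem starHom_apply (a : T.L) : T.starHom a = T.star a := rfl

theorem denseRange_star : DenseRange T.star := by
  refine T.snd_dense.mono ?_
  rintro _ ⟨⟨x, y⟩, h, rfl⟩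
  exact ⟨⟨x, (x, y), h, rfl⟩, T.eq_of_mem_lattice (T.star_spec _) h⟩

theorem project_subset (W : Set H) : T.project W ⊆ T.L := by
  rintro _ ⟨ℓ, rfl, -⟩
  exact ℓ.2

theorem mem_project_iff {W : Set H} (ℓ : T.L) : (ℓ : G) ∈ T.project W ↔ T.star ℓ ∈ W := by
  refine ⟨fun ⟨ℓ', h, h'⟩ => ?_, fun h => ⟨ℓ, rfl, h⟩⟩
  rwa [← Subtype.ext h]

end Star

section Ext

variable {G H : Type*} [AddCommGroup G] [TopologicalSpace G]
  [AddCommGroup H] [TopologicalSpace H] [IsTopologicalAddGroup H]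

theorem snd_mem_bohrHull (S : CPS G H) (y : S.extSpace) : (y : H × Bohr G).2 ∈ bohrHull G := by
  have h := map_mem_closure continuous_snd y.2 (t := range (toBohr G)) ?_
  · exact h
  · rintro _ ⟨_, ⟨⟨a, b⟩, h, rfl⟩, rfl⟩
    exact ⟨a, rfl⟩

/-- The projection from the internal space of the extended scheme to the Bohr component. -/
def extHull (S : CPS G H) : S.extSpace →+ bohrHull G :=
  ((AddMonoidHom.snd H (Bohr G)).comp S.extSpace.subtype).codRestrict _ S.snd_mem_bohrHull

theorem continuous_extHull (S : CPS G H) : Continuous S.extHull :=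
  (continuous_snd.comp continuous_subtype_val).subtype_mk _

theorem extHull_star (S : CPS G H) (ℓ : S.extend.L) :
    S.extHull (S.extend.star ℓ) = toHull G ℓ :=
  Subtype.ext ((S.mem_extLattice _).1 (S.extend.star_spec ℓ)).2

end Ext
end CPS

/-! ### Ideal crystals -/

section Crystal

variable {G : Type*} [AddCommGroup G] [TopologicalSpace G] [IsTopologicalAddGroup G] [T2Space G]

theorem IsLattice.isClosed {Γ : AddSubgroup G} (h : IsLattice Γ) : IsClosed (Γ : Set G) := by
  let _ := IsTopologicalAddGroup.rightUniformSpace G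
  have : IsUniformAddGroup G := isUniformAddGroup_of_addCommGroup
  have := h.discrete
  exact AddSubgroup.isClosed_of_discrete

/-- A lattice is closed in the Bohr topology: the characters of the compact quotient separate the
points outside the lattice from it. -/
theorem IsLattice.mem_of_toHull_mem_closure {Γ : AddSubgroup G} (h : IsLattice Γ) {q : G}
    (hq : toHull G q ∈ closure (toHull G '' Γ)) : q ∈ Γ := by
  have hcl := h.isClosed
  obtain ⟨K, hK, hKu⟩ := h.cocompact
  have : CompactSpace (G ⧸ Γ) := by
    refine ⟨?_⟩
    convert hK.image (QuotientAddGroup.continuous_mk (N := Γ))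
    refine (eq_univ_of_forall fun z => ?_).symm
    obtain ⟨x, rfl⟩ := QuotientAddGroup.mk_surjective z
    obtain ⟨t, ht, k, hk, rfl⟩ := hKu.symm ▸ mem_univ x
    refine ⟨k, hk, QuotientAddGroup.eq.2 ?_⟩
    simpa [add_comm] using ht
  by_contra hqΓ
  obtain ⟨χ, hχ, hadd, hχq⟩ := exists_continuous_character_ne_one
    (a := (QuotientAddGroup.mk' Γ q)) fun h0 => hqΓ ((QuotientAddGroup.eq_zero_iff q).1 h0)
  obtain ⟨ψ, hψ, hψ', -⟩ := exists_bohr_lift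
    (hχ.comp (QuotientAddGroup.continuous_mk (N := Γ))) (fun x y => hadd x y)
  have h1 := map_mem_closure (hψ.comp continuous_subtype_val) hq (t := {1}) ?_
  · rw [closure_singleton] at h1
    exact hχq ((hψ' q).symm.trans h1)
  · rintro _ ⟨t, ht, rfl⟩
    have h0 : χ 0 = 1 := by simpa using hadd 0 0
    refine (hψ' t).trans ?_
    rw [Function.comp_apply, (QuotientAddGroup.eq_zero_iff t).2 ht, h0]

variable {Λ : Set G}

theorem add_mem_crystal_iff {t x : G} (ht : t ∈ AddAction.stabilizer G Λ) :
    t + x ∈ Λ ↔ x ∈ Λ := by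
  have h : t +ᵥ Λ = Λ := AddAction.mem_stabilizer_iff.1 ht
  nth_rewrite 1 [← h]
  exact Set.vadd_mem_vadd_set_iff (a := t)

/-- The translation by a period as a permutation of the crystal. -/
def periodEquiv {t : G} (ht : t ∈ AddAction.stabilizer G Λ) : Λ ≃ Λ where
  toFun := fun x => ⟨t + x, (add_mem_crystal_iff ht).2 x.2⟩
  invFun := fun x => ⟨-t + x, (add_mem_crystal_iff (neg_mem ht)).2 x.2⟩
  left_inv := fun x => by simp
  right_inv := fun x => by simp

/-- An ideal crystal consists of finitely many cosets of its period lattice. -/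
theorem IsIdealCrystal.exists_finite_cosets (hΛ : IsIdealCrystal Λ) :
    ∃ F : Set G, F.Finite ∧ F ⊆ Λ ∧
      ∀ x ∈ Λ, ∃ t ∈ AddAction.stabilizer G Λ, ∃ y ∈ F, x = t + y := by
  obtain ⟨K, hK, hKu⟩ := hΛ.periods.cocompact
  refine ⟨Λ ∩ K, hΛ.locallyFinite K hK, inter_subset_left, fun x hx => ?_⟩
  obtain ⟨t, ht, k, hk, rfl⟩ := hKu.symm ▸ mem_univ x
  exact ⟨t, ht, k, ⟨(add_mem_crystal_iff ht).1 hx, hk⟩, rfl⟩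

/-- The number of points of an ideal crystal in the translates of a compact set is bounded. -/
theorem IsIdealCrystal.exists_card_le (hΛ : IsIdealCrystal Λ) {Q : Set G} (hQ : IsCompact Q) :
    ∃ M : ℕ, ∀ s : G, ∃ A : Finset Λ, A.card ≤ M ∧ ∀ x : Λ, s - x ∈ Q → x ∈ A := by
  obtain ⟨K, hK, hKu⟩ := hΛ.periods.cocompact
  have hfin : {x : Λ | (x : G) ∈ K - Q}.Finite :=
    Set.Finite.of_finite_image ((hΛ.locallyFinite _ (isCompact_sub hK hQ)).subset
      (by rintro _ ⟨i, hi, rfl⟩; exact ⟨i.2, hi⟩)) Subtype.val_injective.injOn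
  refine ⟨hfin.toFinset.card, fun s => ?_⟩
  obtain ⟨t, ht, k, hk, rfl⟩ := hKu.symm ▸ mem_univ s
  refine ⟨hfin.toFinset.map (periodEquiv ht).toEmbedding, (Finset.card_map _).le, fun x hx => ?_⟩
  refine Finset.mem_map.2 ⟨(periodEquiv ht).symm x, ?_, by simp⟩
  rw [Set.Finite.mem_toFinset]
  refine ⟨k, hk, _, hx, ?_⟩
  change k - (t + k - x) = -t + x
  abel

end Crystal

/-! ### Windows of ideal crystals -/

theorem exists_nonempty_interior_of_finite {X ι : Type*} [TopologicalSpace X] {F : Set ι}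
    (hF : F.Finite) {c : ι → Set X} (hc : ∀ i, IsClosed (c i))
    (h : (interior (⋃ i ∈ F, c i)).Nonempty) : ∃ i ∈ F, (interior (c i)).Nonempty := by
  induction F, hF using Set.Finite.induction_on with
  | empty => simp at h
  | @insert a s _ _ ih =>
    by_cases ha : (interior (c a)).Nonempty
    · exact ⟨a, mem_insert _ _, ha⟩
    · rw [biUnion_insert, union_comm, interior_union_isClosed_of_interior_empty
        (‹s.Finite›.isClosed_biUnion fun i _ => hc i) (not_nonempty_iff_eq_empty.1 ha)] at h
      obtain ⟨i, hi, hi'⟩ := ih h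
      exact ⟨i, mem_insert_of_mem _ hi, hi'⟩

section Window

variable {G H : Type*} [AddCommGroup G] [TopologicalSpace G] [IsTopologicalAddGroup G] [T2Space G]
  [AddCommGroup H] [TopologicalSpace H] [IsTopologicalAddGroup H] [T2Space H]
  {T : CPS G H} {Λ : Set G}

theorem CPS.IsModelSet.subset_L (h : T.IsModelSet Λ) : Λ ⊆ T.L := by
  obtain ⟨W, -, -, rfl⟩ := h
  exact T.project_subset W

theorem CPS.IsModelSet.nonempty (h : T.IsModelSet Λ) : Λ.Nonempty := by
  obtain ⟨W, -, hW, rfl⟩ := h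
  obtain ⟨_, h1, ℓ, rfl⟩ := T.denseRange_star.inter_open_nonempty _ isOpen_interior hW
  exact ⟨ℓ, ℓ, rfl, interior_subset h1⟩

theorem CPS.IsModelSet.periods_le (h : T.IsModelSet Λ) : AddAction.stabilizer G Λ ≤ T.L := by
  intro t ht
  obtain ⟨x, hx⟩ := h.nonempty
  have := T.L.sub_mem (h.subset_L ((add_mem_crystal_iff ht).2 hx)) (h.subset_L hx)
  rwa [add_sub_cancel_right] at this

/-- The star map on the periods of a model set. -/
def CPS.IsModelSet.periodStar (h : T.IsModelSet Λ) : AddAction.stabilizer G Λ →+ H :=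
  T.starHom.comp (AddSubgroup.inclusion h.periods_le)

theorem CPS.IsModelSet.exists_compact_periodStar (h : T.IsModelSet Λ) :
    ∃ C, IsCompact C ∧ ∀ t, h.periodStar t ∈ C := by
  obtain ⟨W, hW, -, hΛ⟩ := id h
  refine ⟨closure W - closure W, isCompact_sub hW hW, fun t => ?_⟩
  obtain ⟨x, hx⟩ := h.nonempty
  have hx' := (add_mem_crystal_iff t.2).2 hx
  let ℓ : T.L := ⟨x, h.subset_L hx⟩
  let ℓ' : T.L := ⟨t, h.periods_le t.2⟩
  have h1 : T.star ℓ ∈ W := (T.mem_project_iff ℓ).1 (hΛ ▸ hx)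
  have h2 : T.star (ℓ' + ℓ) ∈ W := (T.mem_project_iff (ℓ' + ℓ)).1 (hΛ ▸ hx')
  refine ⟨_, subset_closure h2, _, subset_closure h1, ?_⟩
  dsimp only
  rw [T.star_add, add_sub_cancel_right]
  rfl

/-- An ideal crystal that is a model set in a scheme extending the Bohr compactification has a
compact open window: the closure of the stars of its periods is a compact open subgroup of the
internal space, which contains no stars of other points, as lattices are closed in the Bohr
topology. -/
theorem CPS.IsModelSet.exists_compact_open_window (h : T.IsModelSet Λ) (hΛ : IsIdealCrystal Λ)
    {β : H →+ bohrHull G} (hβ : Continuous β) (hβstar : ∀ ℓ : T.L, β (T.star ℓ) = toHull G ℓ) :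
    ∃ U : Set H, IsCompact U ∧ IsOpen U ∧ ∀ ℓ : T.L, (ℓ : G) ∈ Λ ↔ T.star ℓ ∈ U := by
  obtain ⟨F, hF, hFΛ, hcos⟩ := hΛ.exists_finite_cosets
  let C : AddSubgroup H := h.periodStar.range.topologicalClosure
  have hCcl : IsClosed (C : Set H) := AddSubgroup.isClosed_topologicalClosure _
  have hC : IsCompact (C : Set H) := by
    obtain ⟨D, hD, hDt⟩ := h.exists_compact_periodStar
    exact hD.closure_of_subset (range_subset_iff.2 hDt)
  have hmem (ℓ : T.L) (hℓ : T.star ℓ ∈ C) : (ℓ : G) ∈ AddAction.stabilizer G Λ := by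
    refine hΛ.periods.mem_of_toHull_mem_closure ?_
    rw [← hβstar]
    refine map_mem_closure hβ hℓ ?_
    rintro _ ⟨t, rfl⟩
    exact ⟨t, t.2, (hβstar ⟨t, h.periods_le t.2⟩).symm⟩
  let c : T.L → Set H := fun ℓ => T.star ℓ +ᵥ (C : Set H)
  have hc (ℓ) : IsClosed (c ℓ) := hCcl.vadd _
  let F' : Set T.L := Subtype.val ⁻¹' F
  have hF' : F'.Finite := hF.preimage Subtype.val_injective.injOn
  have hiff (ℓ : T.L) : (ℓ : G) ∈ Λ ↔ T.star ℓ ∈ ⋃ i ∈ F', c i := by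
    constructor
    · intro hℓ
      obtain ⟨t, ht, y, hy, hty⟩ := hcos ℓ hℓ
      let y' : T.L := ⟨y, h.subset_L (hFΛ hy)⟩
      let t' : T.L := ⟨t, h.periods_le ht⟩
      refine mem_iUnion₂.2 ⟨y', hy, T.star t', subset_closure ⟨⟨t, ht⟩, rfl⟩, ?_⟩
      have : ℓ = y' + t' := Subtype.ext (hty.trans (add_comm _ _))
      rw [this, T.star_add]
      rfl
    · intro hℓ
      obtain ⟨y, hy, z, hz, hyz⟩ := mem_iUnion₂.1 hℓ
      have h1 : T.star (ℓ - y) = z := by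
        rw [← T.starHom_apply, map_sub, T.starHom_apply, T.starHom_apply, ← hyz]
        simp
      have h2 := (add_mem_crystal_iff (x := (y : G)) (hmem (ℓ - y) (h1 ▸ hz))).2 (hFΛ hy)
      simpa using h2
  have hint : (interior (⋃ i ∈ F', c i)).Nonempty := by
    obtain ⟨W, -, hW, hΛW⟩ := id h
    refine hW.mono (interior_maximal ?_ isOpen_interior)
    refine (T.denseRange_star.open_subset_closure_inter isOpen_interior).trans ?_
    refine closure_minimal ?_ (hF'.isClosed_biUnion fun i _ => hc i)
    rintro _ ⟨hz, ℓ, rfl⟩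
    exact (hiff ℓ).1 (hΛW ▸ (T.mem_project_iff ℓ).2 (interior_subset hz))
  have hCo : IsOpen (C : Set H) := by
    obtain ⟨ℓ, -, z, hz⟩ := exists_nonempty_interior_of_finite hF' hc hint
    refine AddSubgroup.isOpen_of_mem_nhds C (g := -T.star ℓ + z) ?_
    have := vadd_mem_nhds_vadd (-T.star ℓ) (mem_interior_iff_mem_nhds.1 hz)
    rwa [neg_vadd_vadd] at this
  exact ⟨_, hF'.isCompact_biUnion fun i _ => hC.vadd _, isOpen_biUnion fun i _ => hCo.vadd _, hiff⟩

end Window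

/-! ### Periodizations over ideal crystals -/

theorem norm_finsum_le_card_mul {ι E : Type*} [NormedAddCommGroup E] {θ : ι → E} {A : Finset ι}
    {M : ℕ} {c : ℝ} (hc0 : 0 ≤ c) (hA : A.card ≤ M) (hθ : ∀ i, θ i ≠ 0 → i ∈ A)
    (hc : ∀ i, ‖θ i‖ ≤ c) : ‖∑ᶠ i, θ i‖ ≤ M * c := by
  rw [finsum_eq_sum_of_support_subset θ (s := A) hθ]
  refine (norm_sum_le_of_le A fun i _ => hc i).trans ?_
  rw [Finset.sum_const, nsmul_eq_mul]
  gcongr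

section Crystal

variable {G : Type*} [AddCommGroup G] [TopologicalSpace G] [IsTopologicalAddGroup G] [T2Space G]
  {Λ : Set G}

/-- A superposition `s ↦ ∑ x ∈ Λ, ψ x (s - x)` of translates along an ideal crystal is almost
periodic if the `ψ x` are uniformly compactly supported, bounded and equicontinuous, and almost
periodic in `x` along the period lattice. -/
theorem IsIdealCrystal.isAlmostPeriodic_finsum (hΛ : IsIdealCrystal Λ) {E : Type*}
    [NormedAddCommGroup E] [ProperSpace E] {ψ : Λ → G → E} {Q : Set G} (hQ : IsCompact Q)
    (hψQ : ∀ x, ∀ v ∉ Q, ψ x v = 0) {B : ℝ} (hB : ∀ x v, ‖ψ x v‖ ≤ B)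
    (hequi : ∀ ε > 0, ∃ U ∈ 𝓝 (0 : G), ∀ x v v', v - v' ∈ U → ‖ψ x v - ψ x v'‖ ≤ ε)
    (hper : ∀ ε > 0, IsRelativelyDense {t : G | ∃ ht : t ∈ AddAction.stabilizer G Λ,
      ∀ x v, ‖ψ (periodEquiv ht x) v - ψ x v‖ ≤ ε}) :
    IsAlmostPeriodic fun s => ∑ᶠ x : Λ, ψ x (s - x) := by
  classical
  obtain ⟨M, hM⟩ := hΛ.exists_card_le hQ
  choose A hAM hA using hM
  have hsupp (s : G) (x : Λ) (h : ψ x (s - x) ≠ 0) : x ∈ A s :=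
    hA s x (by by_contra hx; exact h (hψQ x _ hx))
  have hfin (s : G) : (Function.support fun x : Λ => ψ x (s - x)).Finite :=
    (A s).finite_toSet.subset (hsupp s)
  have hball {V : Set E} (hV : V ∈ 𝓝 0) (N : ℕ) : ∃ ε > 0, ∀ e : E, ‖e‖ ≤ N * ε → e ∈ V := by
    obtain ⟨r, hr, hrV⟩ := Metric.nhds_basis_closedBall.mem_iff.1 hV
    refine ⟨r / (N + 1), by positivity, fun e he => hrV (mem_closedBall_zero_iff.2 (he.trans ?_))⟩
    rw [mul_div_assoc', div_le_iff₀ (by positivity)]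
    nlinarith
  constructor
  · intro V hV
    obtain ⟨ε, hε, hεV⟩ := hball hV (M + M)
    obtain ⟨U, hU, hUε⟩ := hequi ε hε
    refine ⟨U, hU, fun s s' hs => hεV _ ?_⟩
    rw [← finsum_sub_distrib (hfin s) (hfin s')]
    refine norm_finsum_le_card_mul (A := A s ∪ A s') hε.le
      ((Finset.card_union_le _ _).trans (add_le_add (hAM s) (hAM s'))) (fun x hx => ?_)
      fun x => hUε _ _ _ (by simpa using hs)
    rw [Finset.mem_union]
    by_contra! h
    have h1 : ψ x (s - x) = 0 := by_contra fun h' => h.1 (hsupp s x h')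
    have h2 : ψ x (s' - x) = 0 := by_contra fun h' => h.2 (hsupp s' x h')
    exact hx (by rw [h1, h2, sub_zero])
  · refine (isCompact_closedBall (0 : E) (M * max B 0)).closure_of_subset ?_
    rintro _ ⟨s, rfl⟩
    exact mem_closedBall_zero_iff.2 (norm_finsum_le_card_mul (le_max_right _ _) (hAM s) (hsupp s)
      fun x => (hB _ _).trans (le_max_left _ _))
  · intro V hV
    obtain ⟨ε, hε, hεV⟩ := hball hV M
    obtain ⟨K, hK, hKu⟩ := hper ε hε
    refine ⟨K, hK, eq_univ_of_univ_subset (hKu ▸ add_subset_add_right ?_)⟩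
    rintro t ⟨ht, htε⟩ s
    apply hεV
    -- shift the summation variable by the period `t`
    have h1 : ∑ᶠ x : Λ, ψ x (s - x) = ∑ᶠ x : Λ, ψ (periodEquiv ht x) (s - t - x) := by
      rw [← finsum_comp_equiv (periodEquiv ht)]
      refine finsum_congr fun x => congrArg _ ?_
      change s - (t + x) = _
      rw [sub_sub]
    have h2 : (Function.support fun x : Λ => ψ (periodEquiv ht x) (s - t - x)).Finite :=
      (A (s - t)).finite_toSet.subset fun x hx =>
        hA (s - t) x (by by_contra hx'; exact hx (hψQ _ _ hx'))
    rw [h1, ← finsum_sub_distrib (hfin (s - t)) h2]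
    refine norm_finsum_le_card_mul hε.le (hAM (s - t)) (fun x hx => ?_)
      fun x => (norm_sub_rev _ _).trans_le (htε x _)
    refine hA (s - t) x ?_
    by_contra h
    exact hx (by rw [hψQ _ _ h, hψQ _ _ h, sub_zero])

theorem exists_nhds_norm_sub_le {E : Type*} [NormedAddCommGroup E] {φ : G → E}
    (hφ : Continuous φ) (hφ' : HasCompactSupport φ) {ε : ℝ} (hε : 0 < ε) :
    ∃ U ∈ 𝓝 (0 : G), ∀ u v, u - v ∈ U → ‖φ u - φ v‖ ≤ ε := by
  have h := eventually_add_sub_mem hφ hφ' (Metric.closedBall_mem_nhds 0 hε)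
  refine ⟨_, Filter.inter_mem h (neg_mem_nhds_zero G h), fun u v huv => ?_⟩
  by_cases hv : v ∈ tsupport φ
  · simpa using huv.1 v hv
  by_cases hu : u ∈ tsupport φ
  · simpa [norm_sub_rev] using huv.2 u hu
  · simp [image_eq_zero_of_notMem_tsupport hv, image_eq_zero_of_notMem_tsupport hu, hε.le]

/-- Modulations of ideal crystals are strongly almost periodic. -/
theorem IsIdealCrystal.isStronglyAlmostPeriodic_modulate [LocallyCompactSpace G]
    (hΛ : IsIdealCrystal Λ) {w : G → ℂ} {g : G → G} (hw : IsAlmostPeriodic w)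
    (hg : IsAlmostPeriodic g) :
    ((diracComb Λ hΛ.locallyFinite).modulate w g hw hg).IsStronglyAlmostPeriodic := by
  obtain ⟨Bw, hBw⟩ := hw.bounded.isBounded.exists_norm_le
  replace hBw (x) : ‖w x‖ ≤ Bw := hBw _ (subset_closure ⟨x, rfl⟩)
  have hBw0 : 0 ≤ Bw := (norm_nonneg _).trans (hBw 0)
  constructor
  · obtain ⟨K, hK, hK0⟩ := exists_compact_mem_nhds (0 : G)
    obtain ⟨M, hM⟩ := hΛ.exists_card_le (isCompact_sub hg.bounded hK)
    refine ⟨interior K, M * Bw, isOpen_interior, ⟨0, mem_interior_iff_mem_nhds.2 hK0⟩,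
      hK.closure_of_subset interior_subset, fun t ψ hψ hψ1 => ?_⟩
    obtain ⟨A, hAM, hA⟩ := hM t
    change ‖∑ᶠ x : Λ, 1 * (w x * ψ (x + g x))‖ ≤ _
    refine norm_finsum_le_card_mul hBw0 hAM (fun x hx => hA x ?_) fun x => ?_
    · have h1 : (x + g x : G) ∈ t +ᵥ interior K :=
        hψ (subset_tsupport _ (right_ne_zero_of_mul (right_ne_zero_of_mul hx)))
      obtain ⟨k, hk, hkx⟩ := h1
      refine ⟨g x, subset_closure ⟨x, rfl⟩, k, interior_subset hk, ?_⟩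
      change t + k = x + g x at hkx
      change g x - k = t - x
      rw [sub_eq_sub_iff_add_eq_add, hkx, add_comm]
    · rw [one_mul, norm_mul]
      exact (mul_le_mul (hBw x) (hψ1 _) (norm_nonneg _) hBw0).trans_eq (mul_one _)
  · intro φ
    obtain ⟨Bφ, hBφ⟩ := φ.hasCompactSupport.exists_bound_of_continuous φ.continuous
    have hBφ0 : 0 ≤ Bφ := (norm_nonneg _).trans (hBφ 0)
    have hconv : ((diracComb Λ hΛ.locallyFinite).modulate w g hw hg).conv φ =
        fun s => ∑ᶠ x : Λ, w x * φ (s - x - g x) := by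
      funext s
      refine finsum_congr fun x => ?_
      change 1 * (w x * φ (s - (x + g x))) = _
      rw [one_mul, sub_sub]
    rw [hconv]
    refine hΛ.isAlmostPeriodic_finsum (ψ := fun x v => w x * φ (v - g x)) (B := Bw * Bφ)
      (IsCompact.add φ.hasCompactSupport hg.bounded) (fun x v hv => ?_) (fun x v => ?_)
      (fun ε hε => ?_) fun ε hε => ?_
    · have : φ (v - g x) = 0 := by
        by_contra h
        exact hv ⟨v - g x, subset_tsupport _ h, g x, subset_closure ⟨x, rfl⟩, sub_add_cancel _ _⟩
      rw [this, mul_zero]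
    · rw [norm_mul]
      exact mul_le_mul (hBw _) (hBφ _) (norm_nonneg _) hBw0
    · obtain ⟨U, hU, hUε⟩ := exists_nhds_norm_sub_le φ.continuous φ.hasCompactSupport
        (ε := ε / (Bw + 1)) (by positivity)
      refine ⟨U, hU, fun x v v' hv => ?_⟩
      rw [← mul_sub, norm_mul]
      refine (mul_le_mul (hBw _) (hUε _ _ (by simpa using hv)) (norm_nonneg _) hBw0).trans ?_
      rw [mul_div_assoc', div_le_iff₀ (by positivity)]
      nlinarith
    · obtain ⟨w', hw'⟩ := hw.exists_hull_extension
      obtain ⟨g', hg'⟩ := hg.exists_hull_extension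
      obtain ⟨U, hU, hUε⟩ := exists_nhds_norm_sub_le φ.continuous φ.hasCompactSupport
        (ε := ε / 2 / (Bw + 1)) (by positivity)
      have h1 := eventually_add_sub_mem w'.continuous isCompact_univ
        (Metric.closedBall_mem_nhds 0 (show 0 < ε / 2 / (Bφ + 1) by positivity))
      have h2 := eventually_add_sub_mem g'.continuous isCompact_univ hU
      obtain ⟨K, hK, hKu⟩ := hΛ.periods.cocompact.preimage_nhds
        ((toHull G).comp (AddSubgroup.subtype _)) isCompact_univ (fun _ => trivial) (h1.and h2)
      refine ⟨K, hK, eq_univ_of_univ_subset (hKu ▸ add_subset_add_right ?_)⟩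
      rintro t ⟨ht, ht1, ht2⟩
      refine ⟨ht, fun x v => ?_⟩
      change ‖w (t + x) * φ (v - g (t + x)) - w x * φ (v - g x)‖ ≤ ε
      have h3 : ‖w (t + x) - w x‖ ≤ ε / 2 / (Bφ + 1) := by
        have := ht1 (toHull G x) trivial
        rw [AddMonoidHom.comp_apply, ← map_add, hw', hw', add_comm (x : G),
          mem_closedBall_zero_iff] at this
        exact this
      have h4 : ‖φ (v - g (t + x)) - φ (v - g x)‖ ≤ ε / 2 / (Bw + 1) := by
        have := ht2 (toHull G x) trivial
        rw [AddMonoidHom.comp_apply, ← map_add, hg', hg', add_comm (x : G)] at this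
        rw [norm_sub_rev]
        refine hUε _ _ ?_
        rw [sub_sub_sub_cancel_left]
        exact this
      have h5 : w (t + x) * φ (v - g (t + x)) - w x * φ (v - g x) =
          (w (t + x) - w x) * φ (v - g (t + x)) + w x * (φ (v - g (t + x)) - φ (v - g x)) := by
        ring
      rw [h5]
      refine (norm_add_le _ _).trans ?_
      rw [norm_mul, norm_mul]
      have h6 := mul_le_mul h3 (hBφ (v - g (t + x))) (norm_nonneg _) (by positivity)
      have h7 := mul_le_mul (hBw x) h4 (norm_nonneg _) hBw0
      have h8 : ε / 2 / (Bφ + 1) * Bφ ≤ ε / 2 := by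
        rw [div_mul_eq_mul_div, div_le_iff₀ (by positivity)]
        nlinarith
      have h9 : Bw * (ε / 2 / (Bw + 1)) ≤ ε / 2 := by
        rw [mul_div_assoc', div_le_iff₀ (by positivity)]
        nlinarith
      linarith

/-- The differences of points of an ideal crystal do not accumulate at zero. -/
theorem IsIdealCrystal.exists_open_sub_notMem [LocallyCompactSpace G] (hΛ : IsIdealCrystal Λ) :
    ∃ U : Set G, IsOpen U ∧ 0 ∈ U ∧ ∀ x ∈ Λ, ∀ y ∈ Λ, x ≠ y → x - y ∉ U := by
  obtain ⟨K, hK, hK0⟩ := exists_compact_mem_nhds (0 : G)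
  obtain ⟨F, hF, hFΛ, hcos⟩ := hΛ.exists_finite_cosets
  let D : Set G := ⋃ y ∈ F, (fun x => x - y) '' (Λ ∩ (y +ᵥ K))
  have hD : D.Finite := hF.biUnion fun y _ => (hΛ.locallyFinite _ (hK.vadd y)).image _
  refine ⟨interior K ∩ (D \ {0})ᶜ, isOpen_interior.inter
    (hD.subset sdiff_subset).isClosed.isOpen_compl, ⟨mem_interior_iff_mem_nhds.2 hK0, by simp⟩, ?_⟩
  rintro x hx y hy hxy ⟨h1, h2⟩
  obtain ⟨t, ht, z, hz, rfl⟩ := hcos y hy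
  refine h2 ⟨mem_iUnion₂.2 ⟨z, hz, -t + x, ⟨(add_mem_crystal_iff (neg_mem ht)).2 hx, ?_⟩, ?_⟩,
    sub_ne_zero.2 hxy⟩
  · refine ⟨_, interior_subset h1, ?_⟩
    change z + (x - (t + z)) = _
    abel
  · dsimp only
    abel

end Crystal

/-! ### Modulations and deformed weighted variants -/

@[ext]
theorem RadonMeasure.ext {X : Type*} [TopologicalSpace X] {μ ν : RadonMeasure X}
    (h : ∀ φ, μ.toLin φ = ν.toLin φ) : μ = ν := by
  cases μ
  cases ν
  congr
  exact LinearMap.ext h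

section AlmostPeriodic

variable {G E E' : Type*} [AddCommGroup G] [TopologicalSpace G] [IsTopologicalAddGroup G]
  [AddCommGroup E] [TopologicalSpace E] [IsTopologicalAddGroup E]
  [AddCommGroup E'] [TopologicalSpace E'] [IsTopologicalAddGroup E']

theorem IsAlmostPeriodic.hom_comp {f : G → E} (hf : IsAlmostPeriodic f) (e : E →+ E')
    (he : Continuous e) [T2Space E'] : IsAlmostPeriodic fun x => e (f x) where
  uniformContinuous := fun V hV => by
    obtain ⟨U, hU, h⟩ := hf.uniformContinuous (e ⁻¹' V)
      (he.continuousAt.preimage_mem_nhds (by simpa using hV))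
    exact ⟨U, hU, fun x y hxy => by simpa using h x y hxy⟩
  bounded := (hf.bounded.image he).closure_of_subset (by
    rintro _ ⟨x, rfl⟩
    exact ⟨_, subset_closure ⟨x, rfl⟩, rfl⟩)
  relativelyDense := fun V hV => by
    obtain ⟨K, hK, hKu⟩ := hf.relativelyDense (e ⁻¹' V)
      (he.continuousAt.preimage_mem_nhds (by simpa using hV))
    refine ⟨K, hK, eq_univ_of_univ_subset (hKu ▸ add_subset_add_right fun t ht x => ?_)⟩
    simpa using ht x

/-- Almost periodic functions remain almost periodic when evaluated along an almost periodic
deformation of the identity. -/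
theorem IsAlmostPeriodic.comp_add [T2Space G] [T2Space E] {f : G → E} {g : G → G}
    (hf : IsAlmostPeriodic f) (hg : IsAlmostPeriodic g) :
    IsAlmostPeriodic fun x => f (x + g x) := by
  obtain ⟨F, hF⟩ := hf.exists_hull_extension
  obtain ⟨g', hg'⟩ := hg.exists_hull_extension
  refine isAlmostPeriodic_iff.2 ⟨⟨fun b => F (b + toHull G (g' b)), ?_⟩, fun x => ?_⟩
  · exact F.continuous.comp (continuous_id.add (continuous_toHull.comp g'.continuous))
  · change F (toHull G x + toHull G (g' (toHull G x))) = _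
    rw [hg', ← map_add, hF]

theorem IsAlmostPeriodic.add [T2Space E] {f f' : G → E} (hf : IsAlmostPeriodic f)
    (hf' : IsAlmostPeriodic f') : IsAlmostPeriodic fun x => f x + f' x := by
  obtain ⟨F, hF⟩ := hf.exists_hull_extension
  obtain ⟨F', hF'⟩ := hf'.exists_hull_extension
  exact isAlmostPeriodic_iff.2 ⟨F + F', fun x => congrArg₂ (· + ·) (hF x) (hF' x)⟩

theorem IsAlmostPeriodic.mul {f f' : G → ℂ} (hf : IsAlmostPeriodic f)
    (hf' : IsAlmostPeriodic f') : IsAlmostPeriodic fun x => f x * f' x := by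
  obtain ⟨F, hF⟩ := hf.exists_hull_extension
  obtain ⟨F', hF'⟩ := hf'.exists_hull_extension
  exact isAlmostPeriodic_iff.2 ⟨F * F', fun x => congrArg₂ (· * ·) (hF x) (hF' x)⟩

end AlmostPeriodic

section Modulation

variable {G : Type*} [AddCommGroup G] [TopologicalSpace G] [IsTopologicalAddGroup G] [T2Space G]

/-- A modulation of a modulation is a modulation. -/
theorem RadonMeasure.IsModulation.trans {ν μ ρ : RadonMeasure G} (h : ν.IsModulation μ)
    (h' : μ.IsModulation ρ) : ν.IsModulation ρ := by
  obtain ⟨w, g, hw, hg, rfl⟩ := h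
  obtain ⟨w', g', hw', hg', rfl⟩ := h'
  refine ⟨fun x => w x * w' (x + g x), fun x => g x + g' (x + g x), hw.mul (hw'.comp_add hg),
    hg.add (hg'.comp_add hg), RadonMeasure.ext fun φ => congrArg ν.toLin ?_⟩
  ext x
  change w x * (w' (x + g x) * φ (x + g x + g' (x + g x))) =
    w x * w' (x + g x) * φ (x + (g x + g' (x + g x)))
  rw [mul_assoc, add_assoc]

variable {H : Type*} [AddCommGroup H] [TopologicalSpace H] [IsTopologicalAddGroup H] [T2Space H]
  {T : CPS G H} {Λ : Set G}

/-- The modulation of a point set in `L` by `w` and `g` is the deformed weighted model set given by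
`f` and `p` if `w` and `g` agree with `f` and `p` along the star map, and `f` vanishes at the stars
of the other points. -/
theorem modulate_diracComb_eq_deformedWeighted (hΛ : IsLocallyFinite Λ) (hL : Λ ⊆ T.L)
    {f : C_c(H, ℂ)} {p : C(H, G)} {w : G → ℂ} {g : G → G} (hw : IsAlmostPeriodic w)
    (hg : IsAlmostPeriodic g) (hf : ∀ ℓ : T.L, (ℓ : G) ∉ Λ → f (T.star ℓ) = 0)
    (hwf : ∀ ℓ : T.L, (ℓ : G) ∈ Λ → w ℓ = f (T.star ℓ))
    (hgp : ∀ ℓ : T.L, (ℓ : G) ∈ Λ → g ℓ = p (T.star ℓ)) :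
    (diracComb Λ hΛ).modulate w g hw hg = T.deformedWeighted f p := by
  classical
  refine RadonMeasure.ext fun φ => ?_
  let θ : G → ℂ := fun x => w x * φ (x + g x)
  change ∑ᶠ x : Λ, 1 * θ x = ∑ᶠ ℓ : T.L, f (T.star ℓ) * φ (ℓ + p (T.star ℓ))
  have h1 (ℓ : T.L) : f (T.star ℓ) * φ (ℓ + p (T.star ℓ)) = Λ.indicator θ ℓ := by
    by_cases h : (ℓ : G) ∈ Λ
    · rw [indicator_of_mem h, ← hwf ℓ h, ← hgp ℓ h]
    · rw [indicator_of_notMem h, hf ℓ h, zero_mul]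
  simp only [h1, one_mul]
  have h2 : ∑ᶠ x : Λ, θ x = ∑ᶠ x ∈ Λ, θ x := finsum_set_coe_eq_finsum_mem Λ
  have h3 : ∑ᶠ ℓ : T.L, Λ.indicator θ ℓ = ∑ᶠ x ∈ (T.L : Set G), Λ.indicator θ x :=
    finsum_set_coe_eq_finsum_mem (T.L : Set G)
  rw [h2, h3, finsum_mem_def, finsum_mem_def, indicator_indicator, inter_eq_right.2 hL]

/-- If the internal space extends the Bohr compactification, then modulations of deformed weighted
model sets are again deformed weighted model sets: a modulation function is evaluated at the
deformed points by adding the Bohr image of the deformation. -/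
theorem isModulationStable_deformedWeightedModelSets {β : H →+ bohrHull G} (hβ : Continuous β)
    (hβstar : ∀ ℓ : T.L, β (T.star ℓ) = toHull G ℓ) :
    IsModulationStable T.deformedWeightedModelSets := by
  rintro _ ⟨f, p, rfl⟩ _ ⟨w, g, hw, hg, rfl⟩
  obtain ⟨w', hw'⟩ := hw.exists_hull_extension
  obtain ⟨g', hg'⟩ := hg.exists_hull_extension
  have hc : Continuous fun y => β y + toHull G (p y) :=
    hβ.add (continuous_toHull.comp p.continuous)
  have hstar (ℓ : T.L) : β (T.star ℓ) + toHull G (p (T.star ℓ)) =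
      toHull G (ℓ + p (T.star ℓ)) := by
    rw [hβstar, map_add]
  refine ⟨⟨⟨fun y => f y * w' (β y + toHull G (p y)), f.continuous.mul (w'.continuous.comp hc)⟩,
    f.hasCompactSupport.mul_right⟩, ⟨fun y => p y + g' (β y + toHull G (p y)),
      p.continuous.add (g'.continuous.comp hc)⟩, RadonMeasure.ext fun φ => ?_⟩
  refine finsum_congr fun ℓ => ?_
  change f (T.star ℓ) * (w (ℓ + p (T.star ℓ)) *
      φ (ℓ + p (T.star ℓ) + g (ℓ + p (T.star ℓ)))) =
    f (T.star ℓ) * w' (β (T.star ℓ) + toHull G (p (T.star ℓ))) *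
      φ (ℓ + (p (T.star ℓ) + g' (β (T.star ℓ) + toHull G (p (T.star ℓ)))))
  rw [hstar, hw', hg', mul_assoc, add_assoc]

/-- Modulations of an ideal crystal are deformed weighted variants of it: the modulation functions
extend to the Bohr compactification, and the weight is cut off at the compact open window. -/
theorem CPS.IsModelSet.modulations_subset (h : T.IsModelSet Λ) (hΛ : IsIdealCrystal Λ)
    {β : H →+ bohrHull G} (hβ : Continuous β) (hβstar : ∀ ℓ : T.L, β (T.star ℓ) = toHull G ℓ) :
    modulations Λ hΛ.locallyFinite ⊆ T.deformedWeightedVariants Λ := by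
  classical
  rintro _ ⟨w, g, hw, hg, rfl⟩
  obtain ⟨w', hw'⟩ := hw.exists_hull_extension
  obtain ⟨g', hg'⟩ := hg.exists_hull_extension
  obtain ⟨U, hU, hUo, hUΛ⟩ := h.exists_compact_open_window hΛ hβ hβstar
  let f : C_c(H, ℂ) := ⟨⟨U.indicator fun y => w' (β y),
    (w'.continuous.comp hβ).indicator fun y hy => by
      rw [IsClopen.frontier_eq ⟨hU.isClosed, hUo⟩] at hy
      exact hy.elim⟩, HasCompactSupport.intro hU fun y hy =>
      indicator_of_notMem hy fun y => w' (β y)⟩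
  have hf (ℓ : T.L) (hℓ : (ℓ : G) ∉ Λ) : f (T.star ℓ) = 0 :=
    indicator_of_notMem (fun h' => hℓ ((hUΛ ℓ).2 h')) fun y => w' (β y)
  refine ⟨f, ⟨fun y => g' (β y), g'.continuous.comp hβ⟩, hf,
    modulate_diracComb_eq_deformedWeighted hΛ.locallyFinite h.subset_L hw hg hf
      (fun ℓ hℓ => ?_) fun ℓ hℓ => ?_⟩
  · refine Eq.trans ?_ (indicator_of_mem ((hUΛ ℓ).1 hℓ) fun y => w' (β y)).symm
    rw [hβstar, hw']
  · change g ℓ = g' (β (T.star ℓ))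
    rw [hβstar, hg']

/-- A continuous function on the internal space, read off at the points of an ideal crystal via the
star map, is interpolated by an almost periodic function: its values are smeared out by a bump
function supported away from the nonzero differences of points of the crystal. -/
theorem CPS.IsModelSet.exists_isAlmostPeriodic_eq [LocallyCompactSpace G] (h : T.IsModelSet Λ)
    (hΛ : IsIdealCrystal Λ) {E : Type*} [NormedAddCommGroup E] [NormedSpace ℝ E] [ProperSpace E]
    (F : C(H, E)) :
    ∃ w : G → E, IsAlmostPeriodic w ∧ ∀ ℓ : T.L, (ℓ : G) ∈ Λ → w ℓ = F (T.star ℓ) := by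
  obtain ⟨U, hU, hU0, hUΛ⟩ := hΛ.exists_open_sub_notMem
  obtain ⟨b, hb1, hb0, hbc, hb⟩ := exists_continuous_one_zero_of_isCompact
    (isCompact_singleton (x := (0 : G))) hU.isClosed_compl
    (disjoint_compl_right_iff_subset.2 (singleton_subset_iff.2 hU0))
  obtain ⟨W, hW, -, hΛW⟩ := id h
  let ℓ (x : Λ) : T.L := ⟨x, h.subset_L x.2⟩
  have hℓW (x : Λ) : T.star (ℓ x) ∈ closure W :=
    subset_closure ((T.mem_project_iff (ℓ x)).1 (hΛW ▸ x.2))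
  obtain ⟨B, hB⟩ := hW.exists_bound_of_continuousOn F.continuous.continuousOn
  have hB0 : 0 ≤ max B 0 := le_max_right _ _
  have hFB (x : Λ) : ‖F (T.star (ℓ x))‖ ≤ max B 0 := (hB _ (hℓW x)).trans (le_max_left _ _)
  have hbn (v : G) : ‖b v‖ ≤ 1 := by
    rw [Real.norm_of_nonneg (hb v).1]
    exact (hb v).2
  refine ⟨fun s => ∑ᶠ x : Λ, b (s - x) • F (T.star (ℓ x)),
    hΛ.isAlmostPeriodic_finsum (ψ := fun x v => b v • F (T.star (ℓ x))) hbc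
      (fun x v hv => ?_) (B := max B 0) (fun x v => ?_) (fun ε hε => ?_) fun ε hε => ?_,
    fun y hy => ?_⟩
  · rw [image_eq_zero_of_notMem_tsupport hv, zero_smul]
  · rw [norm_smul]
    simpa using mul_le_mul (hbn v) (hFB x) (norm_nonneg _) zero_le_one
  · obtain ⟨N, hN, hNε⟩ := exists_nhds_norm_sub_le b.continuous hbc
      (ε := ε / (max B 0 + 1)) (by positivity)
    refine ⟨N, hN, fun x v v' hv => ?_⟩
    rw [← sub_smul, norm_smul]
    refine (mul_le_mul (hNε _ _ hv) (hFB x) (norm_nonneg _) (by positivity)).trans ?_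
    rw [div_mul_eq_mul_div, div_le_iff₀ (by positivity)]
    nlinarith
  · obtain ⟨C, hC, hCt⟩ := h.exists_compact_periodStar
    have h1 := eventually_add_sub_mem F.continuous hW (Metric.closedBall_mem_nhds 0 hε)
    obtain ⟨K, hK, hKu⟩ := hΛ.periods.cocompact.preimage_nhds h.periodStar hC hCt h1
    refine ⟨K, hK, eq_univ_of_univ_subset (hKu ▸ add_subset_add_right ?_)⟩
    rintro t ⟨ht, htε⟩
    refine ⟨ht, fun x v => ?_⟩
    have h2 : T.star (ℓ (periodEquiv ht x)) = T.star (ℓ x) + h.periodStar ⟨t, ht⟩ := by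
      rw [add_comm]
      exact T.star_add ⟨t, h.periods_le ht⟩ (ℓ x)
    rw [h2, ← smul_sub, norm_smul]
    have h3 := mem_closedBall_zero_iff.1 (htε _ (hℓW x))
    simpa using mul_le_mul (hbn v) h3 (norm_nonneg _) zero_le_one
  · dsimp only
    rw [finsum_eq_single _ (⟨y, hy⟩ : Λ)]
    · rw [sub_self, hb1 rfl]
      exact one_smul _ _
    · intro x hx
      rw [hb0 (hUΛ _ hy _ x.2 fun h' => hx (Subtype.ext h'.symm))]
      exact zero_smul _ _

/-- Over a Euclidean space, deformed weighted variants of an ideal crystal are modulations. -/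
theorem CPS.IsModelSet.deformedWeightedVariants_subset [LocallyCompactSpace G]
    (h : T.IsModelSet Λ) (hΛ : IsIdealCrystal Λ) {E : Type*} [NormedAddCommGroup E]
    [NormedSpace ℝ E] [ProperSpace E] (e : G ≃ₜ+ E) :
    T.deformedWeightedVariants Λ ⊆ modulations Λ hΛ.locallyFinite := by
  rintro _ ⟨f, p, hf, rfl⟩
  obtain ⟨w, hw, hwf⟩ := h.exists_isAlmostPeriodic_eq hΛ f.toContinuousMap
  obtain ⟨g, hg, hgp⟩ := h.exists_isAlmostPeriodic_eq hΛ
    (⟨fun y => e (p y), by fun_prop⟩ : C(H, E))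
  refine ⟨w, _, hw, hg.hom_comp e.symm.toAddMonoidHom e.symm.continuous,
    (modulate_diracComb_eq_deformedWeighted hΛ.locallyFinite h.subset_L hw _ hf hwf
      fun ℓ hℓ => ?_).symm⟩
  rw [hgp ℓ hℓ]
  exact e.symm_apply_apply _

end Modulation

end CutProject

end

theorem theorem9p5 {G H₀ : Type*}
    [AddCommGroup G] [TopologicalSpace G] [IsTopologicalAddGroup G] [T2Space G]
    [LocallyCompactSpace G]
    [AddCommGroup H₀] [TopologicalSpace H₀] [IsTopologicalAddGroup H₀] [T2Space H₀]
    [LocallyCompactSpace H₀]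
    (S : CutProject.CPS G H₀) (Λ : Set G) (hΛ : CutProject.IsIdealCrystal Λ)
    (hmodel : S.extend.IsModelSet Λ) :
    CutProject.modulations Λ hΛ.locallyFinite ⊆ S.extend.deformedWeightedVariants Λ ∧
    (∀ μ ∈ CutProject.modulations Λ hΛ.locallyFinite, μ.IsStronglyAlmostPeriodic) ∧
    (∀ d : ℕ, Nonempty (G ≃ₜ+ EuclideanSpace ℝ (Fin d)) →
      CutProject.modulations Λ hΛ.locallyFinite = S.extend.deformedWeightedVariants Λ) ∧
    CutProject.IsModulationStable S.extend.deformedWeightedModelSets ∧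
    CutProject.IsModulationStable (CutProject.modulations Λ hΛ.locallyFinite) := by
  have hsub := hmodel.modulations_subset hΛ S.continuous_extHull S.extHull_star
  refine ⟨hsub, ?_, fun d ⟨e⟩ => hsub.antisymm (hmodel.deformedWeightedVariants_subset hΛ e),
    CutProject.isModulationStable_deformedWeightedModelSets S.continuous_extHull S.extHull_star,
    fun ν hν μ hμ => hν.trans hμ⟩
  rintro _ ⟨w, g, hw, hg, rfl⟩
  exact hΛ.isStronglyAlmostPeriodic_modulate hw hg
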